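/- Let $\mathbb{D}^2$ be the open unit bidisk, $\mathbb{T}^2$ the torus, and $H^2(\mathbb{D}^2)$ the Hardy space of functions $\sum_{j,k\ge 0} a_{jk}z_1^jz_2^k$ on $\mathbb{D}^2$ with $\sum|a_{jk}|^2<\infty$. For an inner function $\Theta$ on $\mathbb{D}^2$ let $\mathcal{K}_\Theta = H^2(\mathbb{D}^2)\ominus \Theta H^2(\mathbb{D}^2)$. Write $\mathcal{H}(K)$ for the reproducing kernel Hilbert space on $\mathbb{D}^2$ with kernel $K$, and write $\oplus$ for orthogonal direct sums. For $i=1,\dots,m$ let $p_i(z)=a_i+b_iz_1+c_iz_2+d_iz_1z_2$ be a polynomial without zeros in $\mathbb{D}^2$, let $\tilde p_i(z)=\overline{a_i}z_1z_2+\overline{b_i}z_2+\overline{c_i}z_1+\overline{d_i}$, suppose that $p_i$ and $\tilde p_i$ have no common factor and that $\theta_i=\tilde p_i/p_i$ is a rational inner function of degree $(1,1)$, and suppose that $\theta_i$ has a singularity at $(\tau_{1,i},\tau_{2,i})\in\mathbb{T}^2$, that is, $p_i(\tau_{1,i},\tau_{2,i})=0$. Let $\lambda_i,\gamma_i\in\mathbb{C}$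 satisfy $\lambda_i^2=\overline{a_i}c_i-d_i\overline{b_i}$ and $|\gamma_i|^2=|\overline{a_i}b_i-d_i\overline{c_i}|$, and put $$f_i(z)=\frac{\lambda_i(z_2-\tau_{2,i})}{p_i(z)},\qquad g_i(z)=\frac{\gamma_i(z_1-\tau_{1,i})}{p_i(z)},$$ $$\mathcal{S}_{1,\theta_i}=\mathcal{H}\Big(\frac{g_i(z)\overline{g_i(w)}}{1-z_1\overline{w_1}}\Big),\qquad \mathcal{S}_{2,\theta_i}=\mathcal{H}\Big(\frac{f_i(z)\overline{f_i(w)}}{1-z_2\overline{w_2}}\Big).$$ Then each $\mathcal{S}_{j,\theta_i}$ is a closed subspace of $H^2(\mathbb{D}^2)$ (with the inner product of $H^2(\mathbb{D}^2)$). Let $\Theta=\prod_{i=1}^m\theta_i$. For $j=1,2$ the subspaces $\big(\prod_{k=1}^{i-1}\theta_k\big)\mathcal{S}_{j,\theta_i}$, $1\le i\le m$, are pairwise orthogonal in $H^2(\mathbb{D}^2)$, and with $$\mathcal{S}_j:=\bigoplus_{i=1}^m\Big(\prod_{k=1}^{i-1}\theta_k\Big)\mathcal{S}_{j,\theta_i}$$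 one has $\mathcal{K}_\Theta=\mathcal{S}_1\oplus\mathcal{S}_2$, where $\mathcal{S}_1$ is invariant under multiplication by $z_1$ and $\mathcal{S}_2$ is invariant under multiplication by $z_2$. Moreover $$\Big\{f_1,\ \theta_1f_2,\ \theta_1\theta_2f_3,\ \dots,\ \Big(\prod_{k=1}^{m-1}\theta_k\Big)f_m\Big\}$$ is an orthonormal basis of $\mathcal{S}_2\ominus z_2\mathcal{S}_2$. -/

import Mathlib

open scoped ComplexConjugate Topology

noncomputable section

namespace BidiskModel

/-! ### The Hardy space of the bidisk -/

/-- The open unit bidisk in `ℂ²`. -/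
def bidisk : Set (ℂ × ℂ) := {z | ‖z.1‖ < 1 ∧ ‖z.2‖ < 1}

/-- The points of the bidisk. -/
abbrev Bidisk : Type := ↥bidisk

/-- The Hardy space `H²(𝔻²)`, each function `∑ f (j, k) z₁ ^ j z₂ ^ k` being given by its square
summable family of Taylor coefficients at the origin, with `⟪f, g⟫ = ∑ conj (f n) * g n`.
Its elements are (injectively) functions on the bidisk through `H2.ev`, see `instRKHSH2`. -/
abbrev H2 : Type := lp (fun _ : ℕ × ℕ => ℂ) 2

lemma summable_szego (z : Bidisk) :
    Summable fun n : ℕ × ℕ => ‖conj (z.1.1 ^ n.1 * z.1.2 ^ n.2)‖ ^ 2 := by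
  have h1 : Summable fun n : ℕ => (‖z.1.1‖ ^ 2) ^ n :=
    summable_geometric_of_lt_one (by positivity)
      (by have := z.2.1; have := norm_nonneg z.1.1; nlinarith)
  have h2 : Summable fun n : ℕ => (‖z.1.2‖ ^ 2) ^ n :=
    summable_geometric_of_lt_one (by positivity)
      (by have := z.2.2; have := norm_nonneg z.1.2; nlinarith)
  refine (h1.mul_of_nonneg h2 (fun n => by positivity) (fun n => by positivity)).congr ?_
  intro n
  simp only [RCLike.norm_conj, norm_mul, norm_pow, mul_pow, ← pow_mul, mul_comm]

/-- The Szegő kernel vector at `z`, with coefficients `conj (z₁ ^ j * z₂ ^ k)`; the inner product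
with it is the evaluation at `z`. -/
def szego (z : Bidisk) : H2 :=
  ⟨fun n => conj (z.1.1 ^ n.1 * z.1.2 ^ n.2), by
    refine memℓp_gen ?_
    simpa using summable_szego z⟩

lemma hasSum_inner_szego (f : H2) (z : Bidisk) :
    HasSum (fun n : ℕ × ℕ => f n * (z.1.1 ^ n.1 * z.1.2 ^ n.2)) (inner ℂ (szego z) f) := by
  simpa [szego, mul_comm] using lp.hasSum_inner (𝕜 := ℂ) (szego z) f

/-- The value `f(z) = ∑ f (j, k) z₁ ^ j z₂ ^ k` of an element of `H²(𝔻²)` at a point. -/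
def H2.ev (f : H2) (z : Bidisk) : ℂ := ∑' n : ℕ × ℕ, f n * (z.1.1 ^ n.1 * z.1.2 ^ n.2)

lemma H2.ev_eq_inner (f : H2) (z : Bidisk) : f.ev z = inner ℂ (szego z) f :=
  (hasSum_inner_szego f z).tsum_eq

/-- A power series that vanishes on the unit disk has zero coefficients. -/
lemma coeff_eq_zero (c : ℕ → ℂ) (h : ∀ z : ℂ, ‖z‖ < 1 → HasSum (fun n => c n * z ^ n) 0) :
    c = 0 := by
  have hp : HasFPowerSeriesOnBall (fun _ : ℂ => (0 : ℂ))
      (FormalMultilinearSeries.ofScalars ℂ c) 0 (1 / 2) := by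
    refine ⟨?_, by norm_num, ?_⟩
    · have h0 : Filter.Tendsto (fun n => ‖c n‖ * ((1 / 2 : NNReal) : ℝ) ^ n)
          Filter.atTop (𝓝 0) := by
        have := (h (1 / 2) (by norm_num)).summable.tendsto_atTop_zero.norm
        simpa using this
      have := FormalMultilinearSeries.le_radius_of_tendsto
        (p := FormalMultilinearSeries.ofScalars ℂ c) (r := 1 / 2) (l := 0)
        (by simpa [FormalMultilinearSeries.ofScalars_norm] using h0)
      simpa using this
    · intro y hy
      have hy' : ‖y‖ < 1 := by
        have h3 : ‖y‖ₑ < 1 / 2 := by simpa using hy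
        have h4 : ‖y‖ₑ < 1 := h3.trans_le (by norm_num)
        rw [← ofReal_norm, ENNReal.ofReal_lt_one] at h4
        exact h4
      simpa [FormalMultilinearSeries.ofScalars_apply_eq, mul_comm] using h y hy'
  have hz := hp.hasFPowerSeriesAt.eq_zero
  ext n
  have h1 := FormalMultilinearSeries.coeff_ofScalars (𝕜 := ℂ) (p := c) (n := n)
  rw [hz] at h1
  simpa [FormalMultilinearSeries.coeff] using h1.symm

lemma inner_szego_injective (f : H2) (h : ∀ z, inner ℂ (szego z) f = 0) : f = 0 := by
  have key : ∀ z w : ℂ, ‖z‖ < 1 → ‖w‖ < 1 →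
      HasSum (fun n : ℕ × ℕ => f n * (z ^ n.1 * w ^ n.2)) 0 := fun z w hz hw => by
    have := hasSum_inner_szego f ⟨(z, w), hz, hw⟩
    rwa [h] at this
  have hs : ∀ w : ℂ, ‖w‖ < 1 → ∀ j, Summable fun k => f (j, k) * w ^ k := fun w hw j => by
    have := (key (1 / 2) w (by norm_num) hw).summable.prod_factor j
    refine (this.mul_left (2 ^ j)).congr fun k => ?_
    have : (2 : ℂ) ^ j * (1 / 2) ^ j = 1 := by rw [← mul_pow]; norm_num
    linear_combination (f (j, k) * w ^ k) * this
  have h1 : ∀ w : ℂ, ‖w‖ < 1 → (fun j => ∑' k, f (j, k) * w ^ k) = 0 := fun w hw => by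
    refine coeff_eq_zero _ fun z hz => ?_
    have := (key z w hz hw).prod_fiberwise (g := fun j => (∑' k, f (j, k) * w ^ k) * z ^ j)
      fun j => by
        refine ((hs w hw j).hasSum.mul_right (z ^ j)).congr_fun ?_
        intro k
        ring
    exact this
  ext ⟨j, k⟩
  have h2 : (fun k => f (j, k)) = 0 := coeff_eq_zero _ fun w hw => by
    have := (hs w hw j).hasSum
    rwa [show (∑' k, f (j, k) * w ^ k) = 0 from congrFun (h1 w hw) j] at this
  simpa using congrFun h2 k

/-- `H²(𝔻²)` as a Hilbert space of functions on the bidisk. -/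
instance instRKHSH2 : RKHS ℂ H2 Bidisk ℂ where
  coeCLM := ContinuousLinearMap.pi fun z => innerSL ℂ (szego z)
  coeCLM_injective := by
    refine (injective_iff_map_eq_zero _).mpr fun f hf => inner_szego_injective f fun z => ?_
    simpa using congrFun hf z

lemma H2.coeCLM_eq_ev (f : H2) : RKHS.coeCLM ℂ f = f.ev :=
  funext fun z => (f.ev_eq_inner z).symm

lemma H2.ev_injective : Function.Injective H2.ev := fun f g h =>
  RKHS.coeCLM_injective (𝕜 := ℂ) (by simpa only [H2.coeCLM_eq_ev] using h)

lemma H2.ev_zero (z : Bidisk) : (0 : H2).ev z = 0 := by simp [H2.ev_eq_inner]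

lemma H2.ev_add (f g : H2) (z : Bidisk) : (f + g).ev z = f.ev z + g.ev z := by
  simp [H2.ev_eq_inner]

lemma H2.ev_smul (r : ℂ) (f : H2) (z : Bidisk) : (r • f).ev z = r * f.ev z := by
  simp [H2.ev_eq_inner]

/-- A subspace of `H²(𝔻²)`, with the inner product of `H²(𝔻²)`, as a space of functions. -/
instance instRKHSSubmodule (S : Submodule ℂ H2) : RKHS ℂ S Bidisk ℂ where
  coeCLM := (RKHS.coeCLM ℂ : H2 →L[ℂ] Bidisk → ℂ) ∘L S.subtypeL
  coeCLM_injective := RKHS.coeCLM_injective.comp Subtype.val_injective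

/-- The closed subspace of `H²(𝔻²)` generated by the kernel functions `k (·, w)`. If `k` is the
reproducing kernel of a closed subspace of `H²(𝔻²)`, then `kernelSpace k` is that subspace, which
is the space usually written `ℋ(k)`. -/
def kernelSpace (k : Bidisk → Bidisk → ℂ) : Submodule ℂ H2 :=
  (Submodule.span ℂ {h : H2 | ∃ w, ∀ z, h.ev z = k z w}).topologicalClosure

instance (k : Bidisk → Bidisk → ℂ) : CompleteSpace (kernelSpace k) :=
  inferInstanceAs (CompleteSpace (Submodule.topologicalClosure _))

/-- The function `k` is the reproducing kernel of the closed subspace `S` of `H²(𝔻²)`. -/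
def IsReproducingKernel (S : Submodule ℂ H2) [CompleteSpace S] (k : Bidisk → Bidisk → ℂ) : Prop :=
  ∀ z w, RKHS.kernel S z w 1 = k z w

lemma eq_kernelSpace (S : Submodule ℂ H2) [CompleteSpace S] (k : Bidisk → Bidisk → ℂ)
    (h : IsReproducingKernel S k) : S = kernelSpace k := by
  have hk : ∀ w z, ((RKHS.kerFun S w 1 : S) : H2).ev z = k z w := fun w z =>
    (congrFun (H2.coeCLM_eq_ev _) z).symm.trans <| (RKHS.kerFun_apply (H := S) w 1 z).trans (h z w)
  apply le_antisymm
  · intro f hf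
    have hd := RKHS.kerFun_dense (𝕜 := ℂ) (X := Bidisk) (V := ℂ) S
    have hf' : (⟨f, hf⟩ : S) ∈ (Submodule.span ℂ
        {RKHS.kerFun S x v | (x : Bidisk) (v : ℂ)}).topologicalClosure := by
      rw [hd]; trivial
    have hm := map_mem_closure (t := (Submodule.span ℂ
        {h : H2 | ∃ w, ∀ z, h.ev z = k z w} : Set H2)) S.subtypeL.continuous hf' ?_
    · exact hm
    · intro x hx
      have : Submodule.span ℂ {RKHS.kerFun S x v | (x : Bidisk) (v : ℂ)} ≤
          (Submodule.span ℂ {h : H2 | ∃ w, ∀ z, h.ev z = k z w}).comap S.subtype := by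
        rw [Submodule.span_le]
        rintro _ ⟨w, v, rfl⟩
        have hv : RKHS.kerFun S w v = v • RKHS.kerFun S w 1 := by
          rw [← map_smul, smul_eq_mul, mul_one]
        rw [hv]
        exact Submodule.smul_mem _ v (Submodule.subset_span ⟨w, hk w⟩)
      exact this hx
  · have hc : IsClosed (S : Set H2) := (completeSpace_coe_iff_isComplete.mp ‹_›).isClosed
    refine Submodule.topologicalClosure_minimal _ (Submodule.span_le.mpr ?_) hc
    rintro g ⟨w, hg⟩
    have : g = ((RKHS.kerFun S w 1 : S) : H2) := H2.ev_injective (funext fun z => (hg z).trans (hk w z).symm)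
    rw [this]
    exact (RKHS.kerFun S w 1).2

/-! ### Multiplication of subspaces by functions, model spaces -/

/-- The subspace `φ S = {φ g : g ∈ S}` of `H²(𝔻²)`; it is used only for bounded holomorphic `φ`,
for which every product `φ g` is in `H²(𝔻²)`. -/
def mulSpace (φ : ℂ × ℂ → ℂ) (S : Submodule ℂ H2) : Submodule ℂ H2 where
  carrier := {h | ∃ g ∈ S, ∀ z : Bidisk, h.ev z = φ z * g.ev z}
  add_mem' := by
    rintro _ _ ⟨g, hg, h⟩ ⟨g', hg', h'⟩
    exact ⟨g + g', S.add_mem hg hg', fun z => by simp [H2.ev_add, h, h', mul_add]⟩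
  zero_mem' := ⟨0, S.zero_mem, fun z => by simp [H2.ev_zero]⟩
  smul_mem' := by
    rintro r _ ⟨g, hg, h⟩
    exact ⟨r • g, S.smul_mem r hg, fun z => by simp [H2.ev_smul, h]; ring⟩

/-- The subspace `S` is invariant under multiplication by `φ`. -/
def IsMulInvariant (φ : ℂ × ℂ → ℂ) (S : Submodule ℂ H2) : Prop :=
  ∀ g ∈ S, ∃ h ∈ S, ∀ z : Bidisk, h.ev z = φ z * g.ev z

/-- The model space `H²(𝔻²) ⊖ Θ H²(𝔻²)`. -/
def modelSpace (Θ : ℂ × ℂ → ℂ) : Submodule ℂ H2 := (mulSpace Θ ⊤)ᗮ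

/-- Inner functions on the bidisk: bounded and holomorphic, with radial boundary values of modulus
one at almost every point of the torus. -/
def IsInner (F : ℂ × ℂ → ℂ) : Prop :=
  DifferentiableOn ℂ F bidisk ∧ (∃ C : ℝ, ∀ z ∈ bidisk, ‖F z‖ ≤ C) ∧
  ∀ᵐ t : ℝ × ℝ, ∃ w : ℂ, ‖w‖ = 1 ∧
    Filter.Tendsto (fun r : ℝ => F (r * Complex.exp (t.1 * Complex.I),
      r * Complex.exp (t.2 * Complex.I))) (𝓝[<] 1) (𝓝 w)

/-! ### Rational inner functions of degree `(1, 1)` -/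

/-- The coefficients of a polynomial `a + b z₁ + c z₂ + d z₁ z₂`. -/
structure BiPoly where
  (a b c d : ℂ)

namespace BiPoly

/-- The polynomial `p = a + b z₁ + c z₂ + d z₁ z₂`. -/
def poly (p : BiPoly) : MvPolynomial (Fin 2) ℂ :=
  .C p.a + .C p.b * .X 0 + .C p.c * .X 1 + .C p.d * .X 0 * .X 1

/-- The value `p(z)`. -/
def val (p : BiPoly) (z : ℂ × ℂ) : ℂ := p.a + p.b * z.1 + p.c * z.2 + p.d * z.1 * z.2

lemma eval_poly (p : BiPoly) (z : ℂ × ℂ) : MvPolynomial.eval ![z.1, z.2] p.poly = p.val z := by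
  simp [poly, val]

/-- The reflection `p̃ = conj a z₁ z₂ + conj b z₂ + conj c z₁ + conj d` of `p` at degree `(1, 1)`. -/
def refl (p : BiPoly) : BiPoly := ⟨conj p.d, conj p.c, conj p.b, conj p.a⟩

lemma refl_val (p : BiPoly) (z : ℂ × ℂ) (h1 : z.1 ≠ 0) (h2 : z.2 ≠ 0) :
    p.refl.val z = z.1 * z.2 * conj (p.val (1 / conj z.1, 1 / conj z.2)) := by
  simp [refl, val]
  field_simp
  ring

/-- The rational function `θ = p̃ / p`. -/
def theta (p : BiPoly) (z : ℂ × ℂ) : ℂ := p.refl.val z / p.val z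

/-- `p̃ / p` is a rational inner function of degree `(1, 1)`, written in lowest terms with a
denominator that has no zeros in the bidisk. -/
structure IsDegreeOneOneInner (p : BiPoly) : Prop where
  ne_zero : ∀ z ∈ bidisk, p.val z ≠ 0
  isRelPrime : IsRelPrime p.poly p.refl.poly
  degree_fst : max (p.poly.degreeOf 0) (p.refl.poly.degreeOf 0) = 1
  degree_snd : max (p.poly.degreeOf 1) (p.refl.poly.degreeOf 1) = 1
  isInner : IsInner p.theta

/-- The function `g(z) = γ (z₁ - τ₁) / p(z)`. -/
def gFun (p : BiPoly) (γ τ₁ : ℂ) (z : ℂ × ℂ) : ℂ := γ * (z.1 - τ₁) / p.val z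

/-- The function `f(z) = l (z₂ - τ₂) / p(z)`. -/
def fFun (p : BiPoly) (l τ₂ : ℂ) (z : ℂ × ℂ) : ℂ := l * (z.2 - τ₂) / p.val z

/-- The kernel `g(z) conj g(w) / (1 - z₁ conj w₁)`. -/
def kernel₁ (p : BiPoly) (γ τ₁ : ℂ) (z w : Bidisk) : ℂ :=
  p.gFun γ τ₁ z * conj (p.gFun γ τ₁ w) / (1 - z.1.1 * conj w.1.1)

/-- The kernel `f(z) conj f(w) / (1 - z₂ conj w₂)`. -/
def kernel₂ (p : BiPoly) (l τ₂ : ℂ) (z w : Bidisk) : ℂ :=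
  p.fFun l τ₂ z * conj (p.fFun l τ₂ w) / (1 - z.1.2 * conj w.1.2)

end BiPoly

/-! ### Products of such functions -/

/-- The product `Θ = ∏ θ_i`. -/
def bigTheta {m : ℕ} (p : Fin m → BiPoly) (z : ℂ × ℂ) : ℂ := ∏ i, (p i).theta z

/-- The partial product `∏_{k < i} θ_k`. -/
def partialProd {m : ℕ} (p : Fin m → BiPoly) (i : Fin m) (z : ℂ × ℂ) : ℂ :=
  ∏ k ∈ Finset.Iio i, (p k).theta z

/-- The `i`-th summand `(∏_{k < i} θ_k) 𝒮_{1, θ_i}` of `𝒮₁`. -/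
def piece₁ {m : ℕ} (p : Fin m → BiPoly) (γ τ₁ : Fin m → ℂ) (i : Fin m) : Submodule ℂ H2 :=
  mulSpace (partialProd p i) (kernelSpace ((p i).kernel₁ (γ i) (τ₁ i)))

/-- The `i`-th summand `(∏_{k < i} θ_k) 𝒮_{2, θ_i}` of `𝒮₂`. -/
def piece₂ {m : ℕ} (p : Fin m → BiPoly) (l τ₂ : Fin m → ℂ) (i : Fin m) : Submodule ℂ H2 :=
  mulSpace (partialProd p i) (kernelSpace ((p i).kernel₂ (l i) (τ₂ i)))

/-- The sum `𝒮₁` of its summands. -/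
def S₁ {m : ℕ} (p : Fin m → BiPoly) (γ τ₁ : Fin m → ℂ) : Submodule ℂ H2 := ⨆ i, piece₁ p γ τ₁ i

/-- The sum `𝒮₂` of its summands. -/
def S₂ {m : ℕ} (p : Fin m → BiPoly) (l τ₂ : Fin m → ℂ) : Submodule ℂ H2 := ⨆ i, piece₂ p l τ₂ i

/-- The space `ℋ(K₂) = 𝒮₂ ⊖ z₂ 𝒮₂`. -/
def HK₂ {m : ℕ} (p : Fin m → BiPoly) (l τ₂ : Fin m → ℂ) : Submodule ℂ H2 :=
  S₂ p l τ₂ ⊓ (mulSpace Prod.snd (S₂ p l τ₂))ᗮ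

end BidiskModel

end

noncomputable section

namespace BidiskModel

/-! ### Parseval families and coordinate subspaces of a Hilbert basis. -/

section Hilbert

variable {E : Type*} [NormedAddCommGroup E] [InnerProductSpace ℂ E]

/-! The singularity forces an Agler decomposition with one square in each term: `1 - θᵢ(z) conj
θᵢ(w)` equals `(1 - z₁ conj w₁) fᵢ(z) conj fᵢ(w) + (1 - z₂ conj w₂) gᵢ(z) conj gᵢ(w)`
(`Relations.agler`). Multiplied by the factors `θₖ(z) conj θₖ(w)`, `k < i`, these identities
telescope to `1 - Θ(z) conj Θ(w)`. Division by `(1 - z₁ conj w₁)(1 - z₂ conj w₂)` and geometric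
expansion write the Szegő kernel as `∑ eₙ(z) conj eₙ(w)`, where the `eₙ` are the functions `z₂ᵏ (∏
θ) fᵢ`, `z₁ᵏ (∏ θ) gᵢ` and `z₁ʲ z₂ᵏ Θ` (`hasSum_family_kernel`). Such a family is a Parseval frame,
and a Parseval frame of unit vectors is an orthonormal basis (`orthonormal_of_hasSum_kernel`). Once
this basis exists, every space in the theorem is the set of vectors supported on some set of indices
(`IsAdapted`), and the claims become statements about index sets.

The analytic work is that `f`, `g` and `θ` lie in `H²` with norm exactly one. Boundary integrals are
avoided: `p f = l (z₂ - τ₂)` is solved by a Neumann series in the two coordinate shifts, whose terms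
are orthogonal with telescoping norms (`exists_unit_fixed_point`, `exists_unit_solutions`). The case
`m = 1` of the basis then shows that multiplication by `θ` is isometric, which carries the unit
norms to the products.

The algebraic work is `IsDegreeOneOneInner.relations`: absence of zeros in the bidisk together with
a zero on the torus fixes the arguments of the mixed coefficients, and coprimality makes `l` and `γ`
nonzero. -/

lemma sum_norm_inner_sq_le {ι : Type*} {e : ι → E} {M : Submodule ℂ E}
    (hM : M.topologicalClosure = ⊤)
    (h : ∀ x ∈ M, HasSum (fun n => inner ℂ x (e n) * inner ℂ (e n) x) (inner ℂ x x))
    (s : Finset ι) (x : E) : ∑ n ∈ s, ‖inner ℂ (e n) x‖ ^ 2 ≤ ‖x‖ ^ 2 := by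
  have hx : x ∈ closure (M : Set E) := by
    rw [← Submodule.topologicalClosure_coe, hM]; trivial
  -- The bound is a closed condition, and on the dense subspace a partial sum of nonnegative terms
  -- is at most the total.
  refine closure_minimal (s := (M : Set E))
    (t := {x : E | ∑ n ∈ s, ‖inner ℂ (e n) x‖ ^ 2 ≤ ‖x‖ ^ 2}) (fun y hy => ?_)
    (isClosed_le (by fun_prop) (by fun_prop)) hx
  have h1 : HasSum (fun n => ‖inner ℂ (e n) y‖ ^ 2) (‖y‖ ^ 2) := by
    have h2 := Complex.hasSum_re (h y hy)
    rw [← inner_self_eq_norm_sq (𝕜 := ℂ) y]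
    refine h2.congr_fun fun n => ?_
    rw [← inner_conj_symm y (e n), ← Complex.normSq_eq_conj_mul_self, Complex.ofReal_re,
      Complex.normSq_eq_norm_sq]
  exact sum_le_hasSum s (fun n _ => by positivity) h1

/-- A family of unit vectors that resolves the reproducing kernel of a Hilbert space is an
orthonormal basis. -/
theorem orthonormal_of_hasSum_kernel [CompleteSpace E] {X ι : Type*} {k : X → E} {e : ι → E}
    (hk : ∀ h : E, (∀ x, inner ℂ (k x) h = 0) → h = 0) (he : ∀ n, ‖e n‖ = 1)
    (h : ∀ x y, HasSum (fun n => inner ℂ (k x) (e n) * inner ℂ (e n) (k y))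
      (inner ℂ (k x) (k y))) :
    Orthonormal ℂ e ∧ (Submodule.span ℂ (Set.range e))ᗮ = ⊥ := by
  have h1 : ∀ x, ∀ v ∈ Submodule.span ℂ (Set.range k),
      HasSum (fun n => inner ℂ (k x) (e n) * inner ℂ (e n) v) (inner ℂ (k x) v) := by
    intro x v hv
    induction hv using Submodule.span_induction with
    | mem v hv => obtain ⟨y, rfl⟩ := hv; exact h x y
    | zero => simp
    | add u v _ _ hu hv => simpa [inner_add_right, mul_add] using hu.add hv
    | smul c v _ hv =>
      simpa [inner_smul_right, mul_left_comm] using hv.mul_left c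
  have h2 : ∀ v ∈ Submodule.span ℂ (Set.range k), ∀ u ∈ Submodule.span ℂ (Set.range k),
      HasSum (fun n => inner ℂ u (e n) * inner ℂ (e n) v) (inner ℂ u v) := by
    intro v hv u hu
    induction hu using Submodule.span_induction with
    | mem u hu => obtain ⟨x, rfl⟩ := hu; exact h1 x v hv
    | zero => simp
    | add u w _ _ hu hw => simpa [inner_add_left, add_mul] using hu.add hw
    | smul c u _ hu =>
      simpa [inner_smul_left, mul_assoc, mul_comm, mul_left_comm] using hu.mul_left (conj c)
  have hd : (Submodule.span ℂ (Set.range k)).topologicalClosure = ⊤ := by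
    rw [Submodule.topologicalClosure_eq_top_iff, Submodule.eq_bot_iff]
    intro v hv
    refine hk v fun x => ?_
    exact (Submodule.mem_orthogonal _ v).mp hv _ (Submodule.subset_span ⟨x, rfl⟩)
  have hb := sum_norm_inner_sq_le hd fun x hx => h2 x hx x hx
  have ho : Orthonormal ℂ e := by
    refine ⟨he, fun m n hmn => ?_⟩
    classical
    -- Bessel's inequality for the unit vector `e n`: its own coefficient already uses up the whole
    -- norm, so every other coefficient vanishes.
    have h3 := hb {n, m} (e n)
    rw [Finset.sum_pair hmn.symm, inner_self_eq_norm_sq_to_K, he] at h3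
    have h4 : ‖inner ℂ (e m) (e n)‖ ^ 2 ≤ 0 := by
      norm_num at h3
      simp [h3]
    simpa using pow_eq_zero_iff two_ne_zero |>.mp (le_antisymm h4 (by positivity))
  refine ⟨ho, (Submodule.eq_bot_iff _).mpr fun v hv => ?_⟩
  have hv' : ∀ n, inner ℂ (e n) v = 0 := fun n =>
    (Submodule.mem_orthogonal _ v).mp hv _ (Submodule.subset_span ⟨n, rfl⟩)
  refine hk v fun y => ?_
  -- Each `k y` is the sum of its own expansion, so a vector orthogonal to all `e n` is orthogonal
  -- to every `k y`.
  have hs : Summable fun n => inner ℂ (e n) (k y) • e n := by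
    have := (ho.orthogonalFamily.summable_iff_norm_sq_summable
      (f := fun n => inner ℂ (e n) (k y))).mpr (ho.inner_products_summable (x := k y))
    simpa using this
  obtain ⟨u, hu⟩ := hs
  have hu' : u = k y := by
    rw [← sub_eq_zero]
    refine hk _ fun x => ?_
    have h5 := hu.mapL (innerSL ℂ (k x))
    simp only [map_smul, innerSL_apply_apply, smul_eq_mul] at h5
    rw [inner_sub_right, sub_eq_zero]
    refine h5.unique ?_
    simpa [mul_comm] using h x y
  rw [← inner_conj_symm, ← hu']
  have h6 := hu.mapL (innerSL ℂ v)
  simp only [map_smul, innerSL_apply_apply, smul_eq_mul] at h6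
  have h7 : ∀ n, inner ℂ v (e n) = 0 := fun n => by rw [← inner_conj_symm, hv', map_zero]
  simp only [h7, mul_zero] at h6
  rw [h6.unique hasSum_zero, map_zero]

/-- The vectors whose coordinates in the basis `b` are supported in `J`. -/
def coordSubspace {ι : Type*} (b : HilbertBasis ι ℂ E) (J : Set ι) : Submodule ℂ E where
  carrier := {h | ∀ n ∉ J, inner ℂ (b n) h = 0}
  add_mem' hx hy n hn := by rw [inner_add_right, hx n hn, hy n hn, add_zero]
  zero_mem' n _ := inner_zero_right _
  smul_mem' c x hx n hn := by rw [inner_smul_right, hx n hn, mul_zero]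

section Coord

variable {ι : Type*} (b : HilbertBasis ι ℂ E)

lemma mem_coordSubspace {J : Set ι} {h : E} :
    h ∈ coordSubspace b J ↔ ∀ n ∉ J, inner ℂ (b n) h = 0 := Iff.rfl

lemma basis_mem_coordSubspace {J : Set ι} {n : ι} (hn : n ∈ J) : b n ∈ coordSubspace b J :=
  fun _ hm => b.orthonormal.2 fun h => hm (h ▸ hn)

lemma isClosed_coordSubspace (J : Set ι) : IsClosed (coordSubspace b J : Set E) := by
  have : (coordSubspace b J : Set E) = ⋂ n ∈ Jᶜ, {h | inner ℂ (b n) h = 0} := by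
    ext h; simp [mem_coordSubspace]
  rw [this]
  exact isClosed_biInter fun n _ => isClosed_eq (by fun_prop) (by fun_prop)

lemma coordSubspace_mono {J K : Set ι} (h : J ⊆ K) : coordSubspace b J ≤ coordSubspace b K :=
  fun _ hx n hn => hx n fun hJ => hn (h hJ)

lemma coordSubspace_inf (J K : Set ι) :
    coordSubspace b J ⊓ coordSubspace b K = coordSubspace b (J ∩ K) := by
  refine le_antisymm (fun x hx n hn => ?_) (le_inf (coordSubspace_mono b Set.inter_subset_left)
    (coordSubspace_mono b Set.inter_subset_right))
  by_cases hJ : n ∈ J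
  · exact hx.2 n fun hK => hn ⟨hJ, hK⟩
  · exact hx.1 n hJ

lemma coordSubspace_empty : coordSubspace b ∅ = ⊥ := by
  refine (Submodule.eq_bot_iff _).mpr fun x hx => ?_
  have := b.hasSum_repr x
  simp only [b.repr_apply_apply, hx _ (Set.notMem_empty _), zero_smul] at this
  exact this.unique hasSum_zero

lemma coordSubspace_eq_closure {κ : Type*} (σ : κ → ι) {v : κ → E} (hv : ∀ k, v k = b (σ k)) :
    (Submodule.span ℂ (Set.range v)).topologicalClosure = coordSubspace b (Set.range σ) := by
  refine le_antisymm (Submodule.topologicalClosure_minimal _ (Submodule.span_le.mpr ?_)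
    (isClosed_coordSubspace b _)) fun x hx => ?_
  · rintro _ ⟨k, rfl⟩
    rw [hv]
    exact basis_mem_coordSubspace b ⟨k, rfl⟩
  · refine (Submodule.isClosed_topologicalClosure _).mem_of_tendsto (b.hasSum_repr x)
      (Filter.Eventually.of_forall fun s => ?_)
    refine Submodule.le_topologicalClosure _ (Submodule.sum_mem _ fun n _ => ?_)
    by_cases hn : n ∈ Set.range σ
    · obtain ⟨k, rfl⟩ := hn
      exact Submodule.smul_mem _ _ (Submodule.subset_span ⟨k, hv k⟩)
    · rw [b.repr_apply_apply, hx n hn, zero_smul]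
      exact Submodule.zero_mem _

lemma orthogonal_coordSubspace (J : Set ι) : (coordSubspace b J)ᗮ = coordSubspace b Jᶜ := by
  ext x
  rw [Submodule.mem_orthogonal]
  refine ⟨fun h n hn => h _ (basis_mem_coordSubspace b (not_not.mp hn)), fun h y hy => ?_⟩
  rw [← (b.hasSum_inner_mul_inner y x).tsum_eq]
  refine (tsum_congr fun n => ?_).trans tsum_zero
  by_cases hn : n ∈ J
  · rw [h n (not_not.mpr hn), mul_zero]
  · rw [← inner_conj_symm, hy n hn, map_zero, zero_mul]

lemma isOrtho_coordSubspace {J K : Set ι} (h : Disjoint J K) :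
    coordSubspace b J ⟂ coordSubspace b K := by
  rw [Submodule.isOrtho_iff_le, orthogonal_coordSubspace]
  exact coordSubspace_mono b h.subset_compl_right

/-- No closure is needed: once the projection onto the first subspace is removed, the remainder is
supported in `K`. -/
lemma coordSubspace_sup [CompleteSpace E] (J K : Set ι) :
    coordSubspace b J ⊔ coordSubspace b K = coordSubspace b (J ∪ K) := by
  refine le_antisymm (sup_le (coordSubspace_mono b Set.subset_union_left)
    (coordSubspace_mono b Set.subset_union_right)) fun x hx => ?_
  have : CompleteSpace (coordSubspace b J) := (isClosed_coordSubspace b J).completeSpace_coe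
  obtain ⟨y, hy, z, hz, rfl⟩ := (coordSubspace b J).exists_add_mem_mem_orthogonal x
  rw [orthogonal_coordSubspace] at hz
  refine Submodule.add_mem_sup hy fun n hn => ?_
  by_cases hJ : n ∈ J
  · exact hz n (not_not.mpr hJ)
  · have := hx n (by simp [hJ, hn])
    rwa [inner_add_right, hy n hJ, zero_add] at this

lemma iSup_coordSubspace [CompleteSpace E] {κ : Type*} [Finite κ] (J : κ → Set ι) :
    ⨆ i, coordSubspace b (J i) = coordSubspace b (⋃ i, J i) := by
  have := Fintype.ofFinite κ
  classical
  have h : ∀ s : Finset κ, s.sup (fun i => coordSubspace b (J i)) =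
      coordSubspace b (⋃ i ∈ s, J i) := fun s => by
    induction s using Finset.induction_on with
    | empty => simp [coordSubspace_empty]
    | insert i s _ ih =>
      rw [Finset.sup_insert, ih, coordSubspace_sup, Finset.set_biUnion_insert]
  simpa [Finset.sup_univ_eq_iSup] using h Finset.univ

end Coord

/-- An isometry of a complete space is a closed embedding, so images commute with closures. -/
lemma map_closure_span_range [CompleteSpace E] (M : E →ₗᵢ[ℂ] E) {κ : Type*} (v : κ → E) :
    (Submodule.span ℂ (Set.range v)).topologicalClosure.map M.toLinearMap =
      (Submodule.span ℂ (Set.range fun k => M (v k))).topologicalClosure := by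
  apply SetLike.coe_injective
  rw [Submodule.map_coe, Submodule.topologicalClosure_coe, Submodule.topologicalClosure_coe]
  have h : (Set.range fun k => M (v k)) = M.toLinearMap '' Set.range v := by
    rw [← Set.range_comp]; rfl
  rw [h, ← Submodule.map_span, Submodule.map_coe]
  exact (M.isometry.isClosedEmbedding.closure_image_eq _).symm

end Hilbert

/-! ### Solving polynomial equations in a pair of doubly commuting isometries. -/

section Operators

variable {E : Type*} [NormedAddCommGroup E] [InnerProductSpace ℂ E]

lemma orthogonalFamily_span_singleton {u : ℕ → E}
    (hu : ∀ i j, i ≠ j → inner ℂ (u i) (u j) = 0) :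
    OrthogonalFamily ℂ (fun i => (Submodule.span ℂ {u i} : Submodule ℂ E))
      fun i => (Submodule.span ℂ {u i}).subtypeₗᵢ := by
  rintro i j hij ⟨x, hx⟩ ⟨y, hy⟩
  obtain ⟨r, rfl⟩ := Submodule.mem_span_singleton.mp hx
  obtain ⟨s, rfl⟩ := Submodule.mem_span_singleton.mp hy
  simp [inner_smul_left, inner_smul_right, hu i j hij]

lemma exists_hasSum_of_pairwise_orthogonal [CompleteSpace E] {u : ℕ → E} {C : ℝ}
    (hu : ∀ i j, i ≠ j → inner ℂ (u i) (u j) = 0) (hs : HasSum (fun i => ‖u i‖ ^ 2) C) :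
    ∃ f, HasSum u f ∧ ‖f‖ ^ 2 = C := by
  have hO := orthogonalFamily_span_singleton hu
  let v : ∀ i, (Submodule.span ℂ {u i} : Submodule ℂ E) :=
    fun i => ⟨u i, Submodule.mem_span_singleton_self _⟩
  obtain ⟨f, hf⟩ := (hO.summable_iff_norm_sq_summable v).mpr (by simpa [v] using hs.summable)
  have hf' : HasSum u f := hf
  refine ⟨f, hf', tendsto_nhds_unique ((hf'.norm.pow 2)) ?_⟩
  refine Filter.Tendsto.congr (fun s => ?_) hs
  exact (hO.norm_sum v s).symm

lemma norm_sq_smul_add_smul {V : E →L[ℂ] E} (hV : ∀ x, ‖V x‖ = ‖x‖) (a c : ℂ) (v : E) :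
    ‖a • v + c • V v‖ ^ 2 =
      (‖a‖ ^ 2 + ‖c‖ ^ 2) * ‖v‖ ^ 2 + 2 * (conj a * c * inner ℂ v (V v)).re := by
  rw [norm_add_sq (𝕜 := ℂ), norm_smul, norm_smul, hV, inner_smul_left, inner_smul_right,
    ← mul_assoc]
  simp only [RCLike.re_to_complex]
  ring

/-- Commuting isometries `U` and `V` that commute doubly, and a unit vector generating a wandering
subspace, as for the coordinate shifts of the Hardy space of the bidisk. -/
structure IsShiftPair [CompleteSpace E] (U V : E →L[ℂ] E) (e : E) : Prop where
  norm_fst : ∀ x, ‖U x‖ = ‖x‖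
  norm_snd : ∀ x, ‖V x‖ = ‖x‖
  comm : Commute U V
  adjoint_comm : Commute (ContinuousLinearMap.adjoint U) V
  adjoint_apply : ContinuousLinearMap.adjoint U e = 0
  orthonormal : Orthonormal ℂ fun k : ℕ => (V ^ k) e

/-- If `x` is orthogonal to the range of `V - τ`, the numbers `⟪Vᵏ e, x⟫` all have the same modulus.
They are square summable by Bessel, hence zero. -/
lemma mem_closure_range_sub [CompleteSpace E] {V : E →L[ℂ] E} {e : E}
    (he : Orthonormal ℂ fun k : ℕ => (V ^ k) e) {τ : ℂ} (hτ : ‖τ‖ = 1) :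
    e ∈ closure (Set.range fun x => V x - τ • x) := by
  let D : E →L[ℂ] E := V - τ • 1
  have hD : (Set.range fun x => V x - τ • x) = (LinearMap.range (D : E →ₗ[ℂ] E) : Set E) := by
    ext; simp [D]
  rw [hD, ← Submodule.topologicalClosure_coe, ← Submodule.orthogonal_orthogonal_eq_closure,
    SetLike.mem_coe, Submodule.mem_orthogonal']
  intro x hx
  have hx' : ∀ w, inner ℂ (V w) x = conj τ * inner ℂ w x := fun w => by
    have := (Submodule.mem_orthogonal _ x).mp hx (D w) ⟨w, rfl⟩
    simpa [D, inner_sub_left, inner_smul_left, sub_eq_zero] using this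
  have hk : ∀ k : ℕ, inner ℂ ((V ^ k) e) x = conj τ ^ k * inner ℂ e x := fun k => by
    induction k with
    | zero => simp
    | succ k ih =>
      rw [pow_succ', mul_apply_eq_comp, hx', ih, pow_succ']; ring
  have h0 := (he.inner_products_summable (x := x)).tendsto_atTop_zero
  have h1 : ∀ k : ℕ, ‖inner ℂ ((V ^ k) e) x‖ ^ 2 = ‖inner ℂ e x‖ ^ 2 := fun k => by
    rw [hk]; simp [hτ]
  simp only [h1] at h0
  simpa using tendsto_nhds_unique tendsto_const_nhds h0

/-- Cancelling the common power of `U` leaves a positive power on one side only, which the adjoint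
moves onto a vector that it kills. -/
lemma inner_pow_apply_eq_zero [CompleteSpace E] {U : E →L[ℂ] E} (hU : ∀ x, ‖U x‖ = ‖x‖) {x y : E}
    (hx : ContinuousLinearMap.adjoint U x = 0) (hy : ContinuousLinearMap.adjoint U y = 0)
    {i j : ℕ} (hij : i ≠ j) : inner ℂ ((U ^ i) x) ((U ^ j) y) = 0 := by
  have hinner : ∀ x y, inner ℂ (U x) (U y) = inner ℂ x y :=
    (⟨U, hU⟩ : E →ₗᵢ[ℂ] E).inner_map_map
  have h1 : ∀ (k : ℕ) (x y : E), inner ℂ ((U ^ k) x) ((U ^ k) y) = inner ℂ x y := fun k => by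
    induction k with
    | zero => simp
    | succ k ih =>
      intro x y
      rw [pow_succ', mul_apply_eq_comp, mul_apply_eq_comp, hinner, ih]
  rcases lt_or_gt_of_ne hij with h | h
  · obtain ⟨k, rfl⟩ := Nat.exists_eq_add_of_lt h
    rw [add_assoc, pow_add, mul_apply_eq_comp, h1, pow_succ',
      mul_apply_eq_comp, ← ContinuousLinearMap.adjoint_inner_left, hx, inner_zero_left]
  · obtain ⟨k, rfl⟩ := Nat.exists_eq_add_of_lt h
    rw [add_assoc, pow_add, mul_apply_eq_comp, h1, pow_succ',
      mul_apply_eq_comp, ← ContinuousLinearMap.adjoint_inner_right, hy,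
      inner_zero_right]

/-- If `‖x‖² - ‖Q x‖² = ‖T x‖²` for commuting `Q` and `T`, then the powers of `Q` tend to zero
on the closure of the range of `T`. -/
lemma tendsto_pow_apply_zero {Q T : E →L[ℂ] E} (hQT : Commute Q T)
    (h : ∀ x, ‖x‖ ^ 2 - ‖Q x‖ ^ 2 = ‖T x‖ ^ 2) {e : E} (he : e ∈ closure (Set.range T)) :
    Filter.Tendsto (fun n : ℕ => ‖(Q ^ n) e‖) Filter.atTop (𝓝 0) := by
  have hle : ∀ x, ‖Q x‖ ≤ ‖x‖ := fun x =>
    le_of_sq_le_sq (by have := h x; nlinarith [sq_nonneg ‖T x‖]) (norm_nonneg _)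
  have hle' : ∀ (n : ℕ) x, ‖(Q ^ n) x‖ ≤ ‖x‖ := fun n => by
    induction n with
    | zero => simp
    | succ n ih =>
      intro x
      rw [pow_succ', mul_apply_eq_comp]
      exact (hle _).trans (ih x)
  -- Commutation gives `‖Qⁿ T w‖² = ‖Qⁿ w‖² - ‖Qⁿ⁺¹ w‖²`, a difference of consecutive terms of a
  -- convergent sequence.
  have hT : ∀ w, Filter.Tendsto (fun n : ℕ => ‖(Q ^ n) (T w)‖) Filter.atTop (𝓝 0) := fun w => by
    have hanti : Antitone fun n : ℕ => ‖(Q ^ n) w‖ ^ 2 := antitone_nat_of_succ_le fun n => by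
      rw [pow_succ' Q, mul_apply_eq_comp]
      exact pow_le_pow_left₀ (norm_nonneg _) (hle _) 2
    have hlim := tendsto_atTop_ciInf hanti ⟨0, by rintro _ ⟨n, rfl⟩; positivity⟩
    have h1 := hlim.sub (hlim.comp (Filter.tendsto_add_atTop_nat 1))
    rw [sub_self] at h1
    have h2 : Filter.Tendsto (fun n : ℕ => ‖(Q ^ n) (T w)‖ ^ 2) Filter.atTop (𝓝 0) := by
      refine h1.congr fun n => ?_
      have hc : (Q ^ n) (T w) = T ((Q ^ n) w) := DFunLike.congr_fun (hQT.pow_left n).eq w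
      simp only [Function.comp]
      rw [hc, pow_succ' Q, mul_apply_eq_comp, h]
    simpa [Real.sqrt_sq (norm_nonneg _)] using h2.sqrt
  rw [Metric.tendsto_atTop]
  intro ε hε
  obtain ⟨_, ⟨w, rfl⟩, hw⟩ := Metric.mem_closure_iff.mp he (ε / 2) (by positivity)
  obtain ⟨N, hN⟩ := Metric.tendsto_atTop.mp (hT w) (ε / 2) (by positivity)
  refine ⟨N, fun n hn => ?_⟩
  have h3 := hN n hn
  simp only [dist_zero_right, norm_norm] at h3 ⊢
  have h4 : (Q ^ n) e = (Q ^ n) (e - T w) + (Q ^ n) (T w) := by simp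
  rw [dist_eq_norm] at hw
  calc ‖(Q ^ n) e‖ ≤ ‖(Q ^ n) (e - T w)‖ + ‖(Q ^ n) (T w)‖ := by
        rw [h4]; exact norm_add_le _ _
    _ < ε / 2 + ε / 2 := add_lt_add_of_le_of_lt ((hle' n _).trans hw.le) h3
    _ = ε := by ring

/-- The solution of `(1 - U Q) f = T e`. -/
lemma exists_unit_fixed_point [CompleteSpace E] {U Q T : E →L[ℂ] E} {e : E}
    (hU : ∀ x, ‖U x‖ = ‖x‖) (he : ‖e‖ = 1) (hUe : ContinuousLinearMap.adjoint U e = 0)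
    (hUQ' : Commute (ContinuousLinearMap.adjoint U) Q)
    (hUT' : Commute (ContinuousLinearMap.adjoint U) T) (hUQ : Commute U Q) (hQT : Commute Q T)
    (h : ∀ x, ‖x‖ ^ 2 - ‖Q x‖ ^ 2 = ‖T x‖ ^ 2) (heT : e ∈ closure (Set.range T)) :
    ∃ f, ‖f‖ = 1 ∧ f = T e + U (Q f) := by
  -- The terms of the formal series `(1 - U Q)⁻¹ T e = ∑ (U Q)ʲ T e`. They are pairwise orthogonal
  -- because `T Qʲ e` stays in the kernel of the adjoint of `U`.
  let u : ℕ → E := fun j => (U ^ j) (T ((Q ^ j) e))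
  have hUn : ∀ (n : ℕ) x, ‖(U ^ n) x‖ = ‖x‖ := fun n => by
    induction n with
    | zero => simp
    | succ n ih => intro x; rw [pow_succ', mul_apply_eq_comp, hU, ih]
  have hker : ∀ j : ℕ, ContinuousLinearMap.adjoint U (T ((Q ^ j) e)) = 0 := fun j => by
    have h1 : ContinuousLinearMap.adjoint U (T ((Q ^ j) e)) =
        (T * Q ^ j) (ContinuousLinearMap.adjoint U e) :=
      DFunLike.congr_fun (hUT'.mul_right (hUQ'.pow_right j)).eq e
    rw [h1, hUe, map_zero]
  have hs : HasSum (fun j => ‖u j‖ ^ 2) 1 := by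
    rw [hasSum_iff_tendsto_nat_of_nonneg fun j => by positivity]
    -- The hypothesis `h` at `Qⁿ e` makes the sum telescope.
    have h1 : ∀ n : ℕ, ∑ j ∈ Finset.range n, ‖u j‖ ^ 2 = 1 - ‖(Q ^ n) e‖ ^ 2 := fun n => by
      induction n with
      | zero => simp [he]
      | succ n ih =>
        rw [Finset.sum_range_succ, ih, hUn, ← h, pow_succ' Q, mul_apply_eq_comp]
        ring
    simp only [h1]
    simpa using ((tendsto_pow_apply_zero hQT h heT).pow 2).const_sub 1
  obtain ⟨f, hf, hn⟩ := exists_hasSum_of_pairwise_orthogonal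
    (fun i j hij => inner_pow_apply_eq_zero hU (hker i) (hker j) hij) hs
  refine ⟨f, (pow_eq_one_iff_of_nonneg (norm_nonneg f) two_ne_zero).mp hn, ?_⟩
  have h2 : HasSum (fun j => u (j + 1)) (U (Q f)) := by
    have h3 := (hf.mapL Q).mapL U
    refine h3.congr_fun fun j => ?_
    have h4 : u (j + 1) = (U * Q) (u j) := by
      have h5 : U ^ (j + 1) * (T * Q ^ (j + 1)) = U * Q * (U ^ j * (T * Q ^ j)) := by
        rw [pow_succ' U, pow_succ' Q, mul_assoc U Q, ← mul_assoc Q, ← (hUQ.pow_left j).eq,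
          ← mul_assoc T, ← hQT.eq]
        simp only [mul_assoc]
      exact DFunLike.congr_fun h5 e
    exact h4
  have h6 := (hasSum_nat_add_iff' 1).mpr hf
  simp only [Finset.sum_range_one] at h6
  have h7 := h6.unique h2
  rw [← h7]
  simp

/-- For a polynomial `p = a + b z₁ + c z₂ + d z₁ z₂` satisfying the identities below, solutions of
`p f = l (z₂ - τ)` and of `p t = p̃` of norm one. -/
theorem exists_unit_solutions [CompleteSpace E] {U V : E →L[ℂ] E} {e : E} (h : IsShiftPair U V e)
    {a b c d l τ : ℂ} (hca : ‖c‖ < ‖a‖) (hl : l ≠ 0) (hτ : ‖τ‖ = 1)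
    (hC : conj a * c - conj b * d = -(‖l‖ : ℂ) ^ 2 * conj τ)
    (hAD : ‖a‖ ^ 2 + ‖c‖ ^ 2 - ‖b‖ ^ 2 - ‖d‖ ^ 2 = 2 * ‖l‖ ^ 2) :
    (∃ f, ‖f‖ = 1 ∧ a • f + b • U f + c • V f + d • U (V f) = l • (V e - τ • e)) ∧
    ∃ t, ‖t‖ = 1 ∧ a • t + b • U t + c • V t + d • U (V t) =
      conj d • e + conj c • U e + conj b • V e + conj a • U (V e) := by
  have he : ‖e‖ = 1 := by simpa using h.orthonormal.1 0
  have ha : a ≠ 0 := norm_pos_iff.mp ((norm_nonneg c).trans_lt hca)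
  have hunit : IsUnit (a • 1 + c • V : E →L[ℂ] E) := by
    have hn : ‖(-(c / a)) • V‖ < 1 := by
      have hV1 : ‖V‖ ≤ 1 := V.opNorm_le_bound zero_le_one fun x => by rw [h.norm_snd, one_mul]
      rw [norm_smul, norm_neg, norm_div]
      have : ‖c‖ / ‖a‖ < 1 := (div_lt_one (norm_pos_iff.mpr ha)).mpr hca
      calc ‖c‖ / ‖a‖ * ‖V‖ ≤ ‖c‖ / ‖a‖ * 1 := by gcongr
        _ < 1 := by linarith
    have h1 := (isUnit_one_sub_of_norm_lt_one hn).smul (Units.mk0 a ha)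
    convert h1 using 1
    simp only [Units.smul_def, Units.val_mk0]
    rw [smul_sub, smul_smul, mul_neg, mul_div_cancel₀ _ ha, neg_smul, sub_neg_eq_add]
  obtain ⟨P, hP⟩ := hunit
  let R : E →L[ℂ] E := ↑P⁻¹
  have hPR : (a • 1 + c • V) * R = 1 := by rw [← hP]; exact P.mul_inv
  have hcR : ∀ S : E →L[ℂ] E, Commute S V → Commute S R := fun S hS => by
    refine Commute.units_inv_right ?_
    rw [hP]
    exact ((Commute.one_right S).smul_right a).add_right (hS.smul_right c)
  -- With `R = (a + c V)⁻¹` one has `p(U, V) = (1 - U Q)(a + c V)`, so `p(U, V) f = l (V - τ) e`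
  -- becomes `(1 - U Q) f = T e`.
  let Q : E →L[ℂ] E := -((b • 1 + d • V) * R)
  let T : E →L[ℂ] E := (l • (V - τ • 1)) * R
  have hcQ : ∀ S : E →L[ℂ] E, Commute S V → Commute S Q := fun S hS =>
    ((((Commute.one_right S).smul_right b).add_right (hS.smul_right d)).mul_right
      (hcR S hS)).neg_right
  have hcT : ∀ S : E →L[ℂ] E, Commute S V → Commute S T := fun S hS =>
    ((hS.sub_right ((Commute.one_right S).smul_right τ)).smul_right l).mul_right (hcR S hS)
  have hVQ : Commute V Q := hcQ V (Commute.refl V)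
  have hQT : Commute Q T := hcT Q hVQ.symm
  have hPRx : ∀ x, a • R x + c • V (R x) = x := fun x => by
    simpa using DFunLike.congr_fun hPR x
  -- The operator form, at `R x`, of `|a + c ζ|² - |b + d ζ|² = |l|² |ζ - τ|²` for `|ζ| = 1`; its
  -- coefficients are `hC` and `hAD`.
  have hkey : ∀ x, ‖x‖ ^ 2 - ‖Q x‖ ^ 2 = ‖T x‖ ^ 2 := fun x => by
    have h1 : ‖T x‖ ^ 2 = ‖(-(l * τ)) • R x + l • V (R x)‖ ^ 2 := by
      congr 2
      simp [T, smul_sub, smul_smul]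
      abel
    have h2 : ‖Q x‖ ^ 2 = ‖b • R x + d • V (R x)‖ ^ 2 := by
      rw [← norm_neg]; simp [Q]
    have h3 : ‖x‖ ^ 2 = ‖a • R x + c • V (R x)‖ ^ 2 := by rw [hPRx]
    rw [h1, h2, h3, norm_sq_smul_add_smul h.norm_snd, norm_sq_smul_add_smul h.norm_snd,
      norm_sq_smul_add_smul h.norm_snd]
    have h4 : conj (-(l * τ)) * l = conj a * c - conj b * d := by
      rw [hC, ← Complex.conj_mul']; simp; ring
    rw [h4, sub_mul, Complex.sub_re, norm_neg, norm_mul, hτ]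
    linear_combination ‖R x‖ ^ 2 * hAD
  have heT : e ∈ closure (Set.range T) := by
    refine closure_mono ?_ (mem_closure_range_sub h.orthonormal hτ)
    rintro _ ⟨x, rfl⟩
    refine ⟨l⁻¹ • (a • x + c • V x), ?_⟩
    have h1 : T ((a • 1 + c • V) x) = l • (V x - τ • x) := by
      have h2 : T * (a • 1 + c • V) = l • (V - τ • 1) := by
        simp only [T]; rw [mul_assoc, ← hP]; simp [R]
      simpa using DFunLike.congr_fun h2 x
    have h3 : T (a • x + c • V x) = l • (V x - τ • x) := by simpa using h1
    rw [map_smul, h3, smul_smul, inv_mul_cancel₀ hl, one_smul]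
  obtain ⟨f, hf1, hf⟩ := exists_unit_fixed_point h.norm_fst he h.adjoint_apply
    (hcQ _ h.adjoint_comm) (hcT _ h.adjoint_comm) (hcQ _ h.comm) hQT hkey heT
  have hUV : ∀ x, V (U x) = U (V x) := fun x => (DFunLike.congr_fun h.comm.eq x).symm
  have hQx : ∀ x, a • Q x + c • V (Q x) = -(b • x + d • V x) := fun x => by
    have h1 : (a • 1 + c • V) * Q = -(b • 1 + d • V) := by
      have : Commute (a • 1 + c • V : E →L[ℂ] E) Q :=
        ((Commute.one_left Q).smul_left a).add_left (hVQ.smul_left c)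
      rw [this.eq]; simp only [Q]; rw [neg_mul, mul_assoc, ← hP]; simp [R]
    simpa using DFunLike.congr_fun h1 x
  have hTx : ∀ x, a • T x + c • V (T x) = l • (V x - τ • x) := fun x => by
    have h1 : (a • 1 + c • V) * T = l • (V - τ • 1) := by
      have : Commute (a • 1 + c • V : E →L[ℂ] E) T :=
        ((Commute.one_left T).smul_left a).add_left ((hcT V (Commute.refl V)).smul_left c)
      rw [this.eq]; simp only [T]; rw [mul_assoc, ← hP]; simp [R]
    simpa using DFunLike.congr_fun h1 x
  have hpf : a • f + b • U f + c • V f + d • U (V f) = l • (V e - τ • e) := by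
    have h1 := congrArg U (hQx f)
    simp only [map_add, map_smul, map_neg] at h1
    have h2 : a • f + c • V f = a • (T e + U (Q f)) + c • V (T e + U (Q f)) := by rw [← hf]
    rw [map_add, hUV] at h2
    linear_combination (norm := module) h2 + hTx e + h1
  refine ⟨⟨f, hf1, hpf⟩, ?_⟩
  have hRV : ∀ x, R (V x) = V (R x) := fun x =>
    (DFunLike.congr_fun (hcR V (Commute.refl V)).eq x).symm
  have hTV : ∀ x, T (V x) = V (T x) := fun x =>
    (DFunLike.congr_fun (hcT V (Commute.refl V)).eq x).symm
  have hTU : ∀ x, T (U x) = U (T x) := fun x => (DFunLike.congr_fun (hcT U h.comm).eq x).symm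
  have hTdef : ∀ x, T x = l • (V (R x) - τ • R x) := fun x => by simp [T]
  have hQdef : ∀ x, Q x = -(b • R x + d • V (R x)) := fun x => by simp [Q]
  have horth : ∀ S : E →L[ℂ] E, Commute (ContinuousLinearMap.adjoint U) S → ∀ y,
      inner ℂ (S e) (U y) = 0 := fun S hS y => by
    have h1 : ContinuousLinearMap.adjoint U (S e) = S (ContinuousLinearMap.adjoint U e) :=
      DFunLike.congr_fun hS.eq e
    rw [← ContinuousLinearMap.adjoint_inner_left, h1, h.adjoint_apply, map_zero, inner_zero_left]
  -- Splitting off the part of `p̃ / p` at `z₁ = 0`: `p̃ / p = (conj d + conj b z₂) / (a + c z₂) + μ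
  -- z₁ T f`. Indeed `(a + c z₂)(conj c + conj a z₂) - (b + d z₂)(conj d + conj b z₂)` is the
  -- perfect square `μ l² (z₂ - τ)²`, and `μ` has modulus one.
  let S₀ : E →L[ℂ] E := (conj d • 1 + conj b • V) * R
  have hS₀ : Commute (ContinuousLinearMap.adjoint U) S₀ :=
    (((Commute.one_right _).smul_right _).add_right (h.adjoint_comm.smul_right _)).mul_right
      (hcR _ h.adjoint_comm)
  let μ : ℂ := -(‖l‖ : ℂ) ^ 2 * conj τ / l ^ 2
  have hμ : ‖μ‖ = 1 := by
    have : ‖l‖ ≠ 0 := norm_ne_zero_iff.mpr hl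
    simp [μ, hτ, this]
  refine ⟨S₀ e + μ • U (T f), ?_, ?_⟩
  -- Here `‖S₀ e‖ = ‖Q e‖`, and `‖T f‖² = 1 - ‖Q f‖² = ‖T e‖² = 1 - ‖Q e‖²`, so the two parts add up
  -- to one.
  · have h1 : ‖S₀ e + μ • U (T f)‖ ^ 2 = ‖S₀ e‖ ^ 2 + ‖T f‖ ^ 2 := by
      rw [norm_add_sq (𝕜 := ℂ), inner_smul_right, horth S₀ hS₀, norm_smul, hμ, h.norm_fst]
      simp
    have h2 : ‖f‖ ^ 2 = ‖T e‖ ^ 2 + ‖Q f‖ ^ 2 := by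
      conv_lhs => rw [hf]
      rw [norm_add_sq (𝕜 := ℂ), horth T (hcT _ h.adjoint_comm), h.norm_fst]
      simp
    have h3 : ‖S₀ e‖ ^ 2 = ‖Q e‖ ^ 2 := by
      have h4 : S₀ e = conj d • R e + conj b • V (R e) := by simp [S₀]
      rw [h4, hQdef, norm_neg, norm_sq_smul_add_smul h.norm_snd, norm_sq_smul_add_smul h.norm_snd]
      simp only [RCLike.norm_conj, Complex.conj_conj]
      rw [mul_comm d (conj b)]; ring
    have h5 : ‖S₀ e + μ • U (T f)‖ ^ 2 = 1 := by
      rw [h1, h3]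
      have h6 := hkey f
      have h7 := hkey e
      rw [he] at h7
      linarith
    exact (pow_eq_one_iff_of_nonneg (norm_nonneg _) two_ne_zero).mp h5
  · have h1 := congrArg (fun x => U (T x)) hpf
    simp only [map_add, map_sub, map_smul, hTV, hTU] at h1
    have h2 : S₀ e = conj d • R e + conj b • V (R e) := by simp [S₀]
    rw [hTdef e] at h1
    have hC' : a * conj c - b * conj d = -(‖l‖ : ℂ) ^ 2 * τ := by
      have := congrArg conj hC
      simpa using this
    have hAD' : a * conj a + c * conj c - b * conj b - d * conj d = 2 * (‖l‖ : ℂ) ^ 2 := by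
      rw [Complex.mul_conj', Complex.mul_conj', Complex.mul_conj', Complex.mul_conj']
      exact_mod_cast hAD
    have hττ : conj τ * τ = 1 := by rw [Complex.conj_mul', hτ]; norm_num
    have hμl : μ * l ^ 2 = -(‖l‖ : ℂ) ^ 2 * conj τ := by
      simp only [μ]; field_simp
    rw [h2]
    conv_rhs => rw [← hPRx e]
    simp only [map_add, map_sub, map_smul, hUV, smul_add, smul_sub, smul_smul] at h1 ⊢
    set ε := R e
    linear_combination (norm := module) μ • h1
      + hμl • (U (V (V ε)) - (2 * τ) • U (V ε) + τ ^ 2 • U ε)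
      - hC' • U ε - hAD' • U (V ε) - hC • U (V (V ε))
      + hττ • ((2 * (‖l‖ : ℂ) ^ 2) • U (V ε) - ((‖l‖ : ℂ) ^ 2 * τ) • U ε)

end Operators

/-! ### Coefficient identities forced by a singularity on the torus. -/

namespace BiPoly

/-- The polynomial `p(z₂, z₁)`. -/
def swap (p : BiPoly) : BiPoly := ⟨p.a, p.c, p.b, p.d⟩

lemma swap_val (p : BiPoly) (z : ℂ × ℂ) : p.swap.val z = p.val z.swap := by
  simp only [val, swap, Prod.fst_swap, Prod.snd_swap]; ring

lemma swap_ne_zero {p : BiPoly} (h : ∀ z ∈ bidisk, p.val z ≠ 0) :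
    ∀ z ∈ bidisk, p.swap.val z ≠ 0 := fun z hz => by
  rw [swap_val]; exact h _ ⟨hz.2, hz.1⟩

/-- Otherwise, for `z` in the open disk, solving `p(z, z₂) = 0` for `z₂` gives a zero in the bidisk.
The boundary follows by continuity. -/
lemma norm_le_of_ne_zero {p : BiPoly} (h : ∀ z ∈ bidisk, p.val z ≠ 0) {z : ℂ} (hz : ‖z‖ ≤ 1) :
    ‖p.c + p.d * z‖ ≤ ‖p.a + p.b * z‖ := by
  have hlt : ∀ z : ℂ, ‖z‖ < 1 → ‖p.c + p.d * z‖ ≤ ‖p.a + p.b * z‖ := fun z hz => by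
    by_contra! hlt
    have h0 : p.c + p.d * z ≠ 0 := norm_pos_iff.mp ((norm_nonneg _).trans_lt hlt)
    refine h (z, -(p.a + p.b * z) / (p.c + p.d * z)) ⟨hz, ?_⟩ ?_
    · rw [norm_div, norm_neg]
      exact (div_lt_one (norm_pos_iff.mpr h0)).mpr hlt
    · have := div_mul_cancel₀ (-(p.a + p.b * z)) h0
      simp only [val]
      linear_combination this
  have hz' : z ∈ closure (Metric.ball (0 : ℂ) 1) := by
    rw [closure_ball _ one_ne_zero]; simpa using hz
  exact closure_minimal (t := {z : ℂ | ‖p.c + p.d * z‖ ≤ ‖p.a + p.b * z‖})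
    (fun w hw => hlt w (by simpa using hw)) (isClosed_le (by fun_prop) (by fun_prop)) hz'

lemma conj_mul_eq_one {τ : ℂ} (h : ‖τ‖ = 1) : conj τ * τ = 1 := by
  rw [Complex.conj_mul', h]; norm_num

lemma norm_sq_sub_eq (p : BiPoly) {τ₁ τ₂ : ℂ} (hτ₁ : ‖τ₁‖ = 1) (hτ₂ : ‖τ₂‖ = 1)
    (hs : p.val (τ₁, τ₂) = 0) :
    ((‖p.a‖ ^ 2 - ‖p.d‖ ^ 2 : ℝ) : ℂ) = -conj ((conj p.a * p.b - p.d * conj p.c) * τ₁)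
      - conj ((conj p.a * p.c - p.d * conj p.b) * τ₂) ∧
    ((‖p.b‖ ^ 2 - ‖p.c‖ ^ 2 : ℝ) : ℂ) = conj ((conj p.a * p.c - p.d * conj p.b) * τ₂)
      - (conj p.a * p.b - p.d * conj p.c) * τ₁ := by
  have h1 := conj_mul_eq_one hτ₁
  have h2 := conj_mul_eq_one hτ₂
  simp only [val] at hs
  have hs' := congrArg conj hs
  simp only [map_add, map_mul, map_zero] at hs'
  push_cast
  simp only [← Complex.mul_conj', map_mul, map_sub, Complex.conj_conj]
  constructor
  · linear_combination p.a * hs' - conj p.d * conj τ₁ * conj τ₂ * hs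
      + conj p.d * (p.b * conj τ₂ + p.d * τ₂ * conj τ₂) * h1
      + conj p.d * (p.c * conj τ₁ + p.d) * h2
  · linear_combination p.b * τ₁ * hs' - conj p.c * conj τ₂ * hs
      - p.b * (conj p.b + conj p.d * conj τ₂) * h1
      + conj p.c * (p.c + p.d * τ₁) * h2

/-- On the circle `|a + b z|² - |c + d z|²` is a constant plus `2 Re (B z)`. It is nonnegative there
and vanishes at `τ₁`, so `τ₁` minimizes `Re (B z)`, that is, `B τ₁ = -|B|`. -/
lemma eq_neg_norm_of_ne_zero {p : BiPoly} (h : ∀ z ∈ bidisk, p.val z ≠ 0) {τ₁ τ₂ : ℂ}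
    (hτ₁ : ‖τ₁‖ = 1) (hτ₂ : ‖τ₂‖ = 1) (hs : p.val (τ₁, τ₂) = 0) :
    conj p.a * p.b - p.d * conj p.c = -(‖conj p.a * p.b - p.d * conj p.c‖ : ℂ) * conj τ₁ := by
  have h1 := conj_mul_eq_one hτ₁
  set B := conj p.a * p.b - p.d * conj p.c with hB
  have hn : ‖B * τ₁‖ = ‖B‖ := by rw [norm_mul, hτ₁, mul_one]
  suffices hβ : B * τ₁ = -(‖B‖ : ℂ) by
    linear_combination conj τ₁ * hβ - B * h1
  by_cases hB0 : B = 0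
  · simp [hB0]
  have hB0' : ‖B‖ ≠ 0 := norm_ne_zero_iff.mpr hB0
  have hre : ‖B‖ ≤ -(B * τ₁).re := by
    obtain ⟨hA, hD⟩ := p.norm_sq_sub_eq hτ₁ hτ₂ hs
    have hA' := congrArg Complex.re hA
    have hD' := congrArg Complex.re hD
    rw [Complex.ofReal_re] at hA' hD'
    simp only [Complex.sub_re, Complex.neg_re, Complex.conj_re] at hA' hD'
    -- This is the point of the circle at which `Re (B z)` takes its minimum `-|B|`.
    have hz : ‖-conj B / (‖B‖ : ℂ)‖ = 1 := by simp [hB0']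
    have hle := pow_le_pow_left₀ (norm_nonneg _) (norm_le_of_ne_zero h hz.le) 2
    have hexp : ∀ x y z : ℂ, ‖z‖ = 1 → ‖x + y * z‖ ^ 2 =
        ‖x‖ ^ 2 + ‖y‖ ^ 2 + 2 * (conj x * y * z).re := fun x y z hz => by
      rw [norm_add_sq (𝕜 := ℂ), norm_mul, hz]
      simp only [RCLike.inner_apply, RCLike.re_to_complex]
      rw [mul_one, show y * z * conj x = conj x * y * z by ring]
      ring
    rw [hexp _ _ _ hz, hexp _ _ _ hz] at hle
    have hBz : (conj p.a * p.b * (-conj B / (‖B‖ : ℂ))).re -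
        (conj p.c * p.d * (-conj B / (‖B‖ : ℂ))).re = -‖B‖ := by
      rw [← Complex.sub_re, ← sub_mul, show conj p.a * p.b - conj p.c * p.d = B by rw [hB]; ring,
        mul_div_assoc', mul_neg, Complex.mul_conj']
      have : -(‖B‖ : ℂ) ^ 2 / (‖B‖ : ℂ) = ((-‖B‖ : ℝ) : ℂ) := by
        have : (‖B‖ : ℂ) ≠ 0 := by exact_mod_cast hB0'
        push_cast; field_simp
      rw [this, Complex.ofReal_re]
    linarith
  have hsq := Complex.sq_norm (B * τ₁)
  rw [hn, Complex.normSq_apply] at hsq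
  have hre' : |(B * τ₁).re| ≤ ‖B‖ := hn ▸ Complex.abs_re_le_norm _
  have hre2 : (B * τ₁).re = -‖B‖ := le_antisymm (by linarith) (abs_le.mp hre').1
  have him : (B * τ₁).im = 0 := by
    rw [hre2] at hsq
    have : (B * τ₁).im * (B * τ₁).im = 0 := by linarith
    simpa using this
  apply Complex.ext <;> simp [hre2, him]

section Degree

open MvPolynomial

lemma degreeOf_eq_zero_of_dvd {i : Fin 2} {P P₀ P₁ : MvPolynomial (Fin 2) ℂ}
    (h₀ : P₀.degreeOf i = 0) (h₁ : P₁.degreeOf i = 0) (hP : P = P₀ + P₁ * X i) (hd : P ∣ P₁) :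
    P.degreeOf i = 0 := by
  by_cases h : P₁ = 0
  · rw [hP, h, zero_mul, add_zero, h₀]
  · obtain ⟨R, rfl⟩ := hd
    rw [degreeOf_mul_eq (left_ne_zero_of_mul h) (right_ne_zero_of_mul h)] at h₁
    omega

lemma degreeOf_C_add_C_mul_X {i j : Fin 2} (hij : i ≠ j) (a b : ℂ) :
    (C a + C b * X j : MvPolynomial (Fin 2) ℂ).degreeOf i = 0 := by
  refine Nat.le_zero.mp ((degreeOf_add_le _ _ _).trans (max_le (by simp) ?_))
  refine (degreeOf_mul_le _ _ _).trans ?_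
  simp [degreeOf_X, hij]

/-- If the resultant of `p` and `p̃` with respect to a variable vanishes, then they have a common
factor or do not depend on this variable. -/
lemma not_isRelPrime_of_resultant_eq_zero {i j : Fin 2} (hij : i ≠ j) {a b c d : ℂ}
    {P P' : MvPolynomial (Fin 2) ℂ}
    (hP : P = C a + C b * X i + C c * X j + C d * X i * X j)
    (hP' : P' = C (conj d) + C (conj c) * X i + C (conj b) * X j + C (conj a) * X i * X j)
    (h : IsRelPrime P P') (hdeg : max (P.degreeOf i) (P'.degreeOf i) = 1)
    (hC : conj a * c - d * conj b = 0) (hAD : a * conj a + c * conj c = b * conj b + d * conj d) :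
    False := by
  have hPe : P = (C a + C c * X j) + (C b + C d * X j) * X i := by rw [hP]; ring
  have hPe' : P' = (C (conj d) + C (conj b) * X j) + (C (conj c) + C (conj a) * X j) * X i := by
    rw [hP']; ring
  have hC' : a * conj c - conj d * b = 0 := by simpa using congrArg conj hC
  have hC1 := congrArg (C (R := ℂ) (σ := Fin 2)) hC
  have hC2 := congrArg (C (R := ℂ) (σ := Fin 2)) hC'
  have hC3 := congrArg (C (R := ℂ) (σ := Fin 2)) hAD
  simp only [map_sub, map_mul, map_add, map_zero] at hC1 hC2 hC3
  -- The two sides differ by the resultant in `X i`, whose coefficients are `hC2`, `hC3`, `hC1`.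
  -- Coprimality then makes each polynomial divide its own coefficient of `X i`, which has degree
  -- zero in `X i`.
  have key : (C (conj c) + C (conj a) * X j) * P = (C b + C d * X j) * P' := by
    rw [hPe, hPe']
    linear_combination hC2 + hC3 * X j + hC1 * X j ^ 2
  have hd : P ∣ C b + C d * X j := h.dvd_of_dvd_mul_right (Dvd.intro_left _ key)
  have hd' : P' ∣ C (conj c) + C (conj a) * X j :=
    h.symm.dvd_of_dvd_mul_right (Dvd.intro_left _ key.symm)
  have h1 := degreeOf_eq_zero_of_dvd (degreeOf_C_add_C_mul_X hij _ _)
    (degreeOf_C_add_C_mul_X hij _ _) hPe hd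
  have h2 := degreeOf_eq_zero_of_dvd (degreeOf_C_add_C_mul_X hij _ _)
    (degreeOf_C_add_C_mul_X hij _ _) hPe' hd'
  rw [h1, h2] at hdeg
  simp at hdeg

end Degree

/-- The coefficient identities for a polynomial whose quotient `p̃ / p` has a singularity at
`(τ₁, τ₂)`; they amount to
`p(z) conj p(w) - p̃(z) conj p̃(w) = (1 - z₁ conj w₁) l (z₂ - τ₂) conj (l (w₂ - τ₂)) +
(1 - z₂ conj w₂) γ (z₁ - τ₁) conj (γ (w₁ - τ₁))`. -/
structure Relations (p : BiPoly) (τ₁ τ₂ l γ : ℂ) : Prop where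
  norm_fst : ‖τ₁‖ = 1
  norm_snd : ‖τ₂‖ = 1
  coeff_fst : conj p.a * p.b - conj p.c * p.d = -(‖γ‖ : ℂ) ^ 2 * conj τ₁
  coeff_snd : conj p.a * p.c - conj p.b * p.d = -(‖l‖ : ℂ) ^ 2 * conj τ₂
  coeff_add : ‖p.a‖ ^ 2 - ‖p.d‖ ^ 2 = ‖l‖ ^ 2 + ‖γ‖ ^ 2
  coeff_sub : ‖p.b‖ ^ 2 - ‖p.c‖ ^ 2 = ‖γ‖ ^ 2 - ‖l‖ ^ 2
  l_ne_zero : l ≠ 0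
  γ_ne_zero : γ ≠ 0
  c_lt : ‖p.c‖ < ‖p.a‖
  b_lt : ‖p.b‖ < ‖p.a‖

/-- The strict inequality makes `a + c V` invertible. If `|c| = |a|`, then `|b|² - |d|² = 2 G` while
`|a| (|b| - |d|) ≤ G`, so `2 |a| ≤ |b| + |d|`, contradicting `|d| < |b| ≤ |a|`. -/
lemma lt_of_coeff {a b c d τ : ℂ} {L G : ℝ} (hG : 0 < G) (hτ : ‖τ‖ = 1)
    (hB : conj a * b - d * conj c = -(G : ℂ) * τ) (hA : ‖a‖ ^ 2 - ‖d‖ ^ 2 = L + G)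
    (hD : ‖b‖ ^ 2 - ‖c‖ ^ 2 = G - L) (hba : ‖b‖ ≤ ‖a‖) (hca : ‖c‖ ≤ ‖a‖) : ‖c‖ < ‖a‖ := by
  refine lt_of_le_of_ne hca fun h => ?_
  have hn : ‖conj a * b - d * conj c‖ = G := by rw [hB]; simp [hτ, abs_of_pos hG]
  have h1 := norm_sub_norm_le (conj a * b) (d * conj c)
  rw [hn, norm_mul, norm_mul, RCLike.norm_conj, RCLike.norm_conj, h] at h1
  rw [h] at hD
  have h2 : (‖b‖ - ‖d‖) * (‖b‖ + ‖d‖) = 2 * G := by linarith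
  have hb := norm_nonneg b
  have hd := norm_nonneg d
  have h3 : 0 < ‖b‖ - ‖d‖ := by
    by_contra! h3
    nlinarith
  have h4 : (‖b‖ - ‖d‖) * (2 * ‖a‖ - (‖b‖ + ‖d‖)) ≤ 0 := by linarith
  have h5 : 0 < 2 * ‖a‖ - (‖b‖ + ‖d‖) := by linarith
  nlinarith [mul_pos h3 h5]

theorem IsDegreeOneOneInner.relations {p : BiPoly} (hp : p.IsDegreeOneOneInner) {τ₁ τ₂ l γ : ℂ}
    (hτ₁ : ‖τ₁‖ = 1) (hτ₂ : ‖τ₂‖ = 1) (hs : p.val (τ₁, τ₂) = 0)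
    (hl : l ^ 2 = conj p.a * p.c - p.d * conj p.b)
    (hγ : ‖γ‖ ^ 2 = ‖conj p.a * p.b - p.d * conj p.c‖) : p.Relations τ₁ τ₂ l γ := by
  have hB := eq_neg_norm_of_ne_zero hp.ne_zero hτ₁ hτ₂ hs
  have hC := eq_neg_norm_of_ne_zero (swap_ne_zero hp.ne_zero) hτ₂ hτ₁
    (by rw [swap_val]; exact hs)
  simp only [swap] at hC
  have hl' : ‖l‖ ^ 2 = ‖conj p.a * p.c - p.d * conj p.b‖ := by rw [← hl, norm_pow]
  rw [← hγ] at hB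
  rw [← hl'] at hC
  obtain ⟨hA, hD⟩ := p.norm_sq_sub_eq hτ₁ hτ₂ hs
  have h1 := conj_mul_eq_one hτ₁
  have h2 := conj_mul_eq_one hτ₂
  have hB1 : (conj p.a * p.b - p.d * conj p.c) * τ₁ = ((-‖γ‖ ^ 2 : ℝ) : ℂ) := by
    rw [hB, mul_assoc, h1]; push_cast; ring
  have hC1 : (conj p.a * p.c - p.d * conj p.b) * τ₂ = ((-‖l‖ ^ 2 : ℝ) : ℂ) := by
    rw [hC, mul_assoc, h2]; push_cast; ring
  rw [hB1, hC1, Complex.conj_ofReal, Complex.conj_ofReal] at hA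
  rw [hB1, hC1, Complex.conj_ofReal] at hD
  have hA' : ‖p.a‖ ^ 2 - ‖p.d‖ ^ 2 = ‖l‖ ^ 2 + ‖γ‖ ^ 2 := by
    have : ‖p.a‖ ^ 2 - ‖p.d‖ ^ 2 = -(-‖γ‖ ^ 2) - -‖l‖ ^ 2 := by exact_mod_cast hA
    linarith
  have hD' : ‖p.b‖ ^ 2 - ‖p.c‖ ^ 2 = ‖γ‖ ^ 2 - ‖l‖ ^ 2 := by
    have : ‖p.b‖ ^ 2 - ‖p.c‖ ^ 2 = -‖l‖ ^ 2 - -‖γ‖ ^ 2 := by exact_mod_cast hD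
    linarith
  have hl0 : l ≠ 0 := fun h => by
    refine not_isRelPrime_of_resultant_eq_zero (i := 0) (j := 1) (by decide) (a := p.a) (b := p.b)
      (c := p.c) (d := p.d) rfl (by simp [refl, poly]) hp.isRelPrime hp.degree_fst ?_ ?_
    · rw [← hl, h]; simp
    · have h0 : ‖l‖ = 0 := by simp [h]
      rw [h0] at hA' hD'
      simp only [Complex.mul_conj']
      exact_mod_cast (by linarith : ‖p.a‖ ^ 2 + ‖p.c‖ ^ 2 = ‖p.b‖ ^ 2 + ‖p.d‖ ^ 2)
  have hγ0 : γ ≠ 0 := fun h => by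
    -- The same argument with the variables, hence `b` and `c`, exchanged.
    refine not_isRelPrime_of_resultant_eq_zero (i := 1) (j := 0) (by decide) (a := p.a) (b := p.c)
      (c := p.b) (d := p.d) (by simp [poly]; ring) (by simp [refl, poly]; ring)
      hp.isRelPrime hp.degree_snd ?_ ?_
    · rw [← norm_eq_zero, ← hγ, h]; simp
    · have h0 : ‖γ‖ = 0 := by simp [h]
      rw [h0] at hA' hD'
      simp only [Complex.mul_conj']
      exact_mod_cast (by linarith : ‖p.a‖ ^ 2 + ‖p.b‖ ^ 2 = ‖p.c‖ ^ 2 + ‖p.d‖ ^ 2)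
  have hca : ‖p.c‖ ≤ ‖p.a‖ := by
    simpa using norm_le_of_ne_zero hp.ne_zero (z := 0) (by simp)
  have hba : ‖p.b‖ ≤ ‖p.a‖ := by
    simpa [swap] using norm_le_of_ne_zero (swap_ne_zero hp.ne_zero) (z := 0) (by simp)
  have hG : 0 < ‖γ‖ ^ 2 := by positivity
  have hL : 0 < ‖l‖ ^ 2 := by positivity
  refine ⟨hτ₁, hτ₂, ?_, ?_, hA', hD', hl0, hγ0, ?_, ?_⟩
  · rw [mul_comm (conj p.c), hB]; push_cast; ring
  · rw [mul_comm (conj p.b), hC]; push_cast; ring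
  · exact lt_of_coeff hG (by simpa using hτ₁) hB hA' hD' hba hca
  · exact lt_of_coeff (L := ‖γ‖ ^ 2) hL (by simpa using hτ₂) hC (by linarith) (by linarith) hca hba

/-- The Agler decomposition of `p̃ / p`. -/
theorem Relations.agler {p : BiPoly} {τ₁ τ₂ l γ : ℂ} (h : p.Relations τ₁ τ₂ l γ) {z w : ℂ × ℂ}
    (hz : p.val z ≠ 0) (hw : p.val w ≠ 0) :
    1 - p.theta z * conj (p.theta w) =
      (1 - z.1 * conj w.1) * (p.fFun l τ₂ z * conj (p.fFun l τ₂ w)) +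
      (1 - z.2 * conj w.2) * (p.gFun γ τ₁ z * conj (p.gFun γ τ₁ w)) := by
  have hw' : conj (p.val w) ≠ 0 := by simpa using hw
  have h1 := conj_mul_eq_one h.norm_fst
  have h2 := conj_mul_eq_one h.norm_snd
  have hB := h.coeff_fst
  have hC := h.coeff_snd
  have hB' := congrArg conj hB
  have hC' := congrArg conj hC
  have hA : p.a * conj p.a - p.d * conj p.d = l * conj l + γ * conj γ := by
    simp only [Complex.mul_conj']; exact_mod_cast h.coeff_add
  have hD : p.b * conj p.b - p.c * conj p.c = γ * conj γ - l * conj l := by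
    simp only [Complex.mul_conj']; exact_mod_cast h.coeff_sub
  have key : p.val z * conj (p.val w) - p.refl.val z * conj (p.refl.val w) =
      (1 - z.1 * conj w.1) * (l * (z.2 - τ₂) * conj (l * (w.2 - τ₂))) +
      (1 - z.2 * conj w.2) * (γ * (z.1 - τ₁) * conj (γ * (w.1 - τ₁))) := by
    rw [← Complex.mul_conj'] at hB hC
    simp only [← Complex.mul_conj', map_mul, map_sub, map_neg, Complex.conj_conj] at hB' hC'
    simp only [val, refl, map_add, map_mul, map_sub, Complex.conj_conj]
    obtain ⟨z₁, z₂⟩ := z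
    obtain ⟨w₁, w₂⟩ := w
    simp only
    linear_combination (1 - z₁ * z₂ * conj w₁ * conj w₂) * hA + (z₁ * conj w₁ - z₂ * conj w₂) * hD
      + (z₁ - z₁ * z₂ * conj w₂) * hB + (z₂ - z₁ * z₂ * conj w₁) * hC
      + (conj w₁ - z₂ * conj w₁ * conj w₂) * hB' + (conj w₂ - z₁ * conj w₁ * conj w₂) * hC'
      - (1 - z₂ * conj w₂) * γ * conj γ * h1 - (1 - z₁ * conj w₁) * l * conj l * h2
  simp only [theta, fFun, gFun, map_div₀]
  rw [eq_comm, ← sub_eq_zero] at key ⊢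
  have : (p.val z * conj (p.val w)) ≠ 0 := mul_ne_zero hz hw'
  field_simp
  linear_combination key

end BiPoly

/-! ### The coordinate shifts on `H²(𝔻²)` and the unit vectors `f`, `g`, `θ`. -/

/-- The monomial `z₁ ^ j * z₂ ^ k`. -/
def monomial (n : ℕ × ℕ) : H2 := lp.single 2 n (1 : ℂ)

lemma inner_monomial (n : ℕ × ℕ) (f : H2) : inner ℂ (monomial n) f = f n := by
  rw [monomial, lp.inner_single_left]; simp

lemma monomial_apply (m n : ℕ × ℕ) : (monomial m : H2) n = if m = n then 1 else 0 := by
  rw [monomial, lp.single_apply]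
  by_cases h : m = n
  · subst h; simp
  · rw [Pi.single_eq_of_ne (Ne.symm h), if_neg h]

lemma orthonormal_monomial : Orthonormal ℂ monomial := by
  rw [orthonormal_iff_ite]
  intro m n
  rw [inner_monomial, monomial_apply]
  simp [eq_comm]

lemma ev_monomial (n : ℕ × ℕ) (z : Bidisk) :
    (monomial n).ev z = z.1.1 ^ n.1 * z.1.2 ^ n.2 := by
  rw [H2.ev, tsum_eq_single n]
  · simp [monomial_apply]
  · intro m hm; simp [monomial_apply, hm.symm]

lemma hasSum_monomial (f : H2) : HasSum (fun n => f n • monomial n) f := by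
  have := lp.hasSum_single (E := fun _ : ℕ × ℕ => ℂ) (p := 2) (by norm_num) f
  refine this.congr_fun fun n => ?_
  rw [monomial, ← lp.single_smul]; simp

lemma hasSum_ev {ι : Type*} {u : ι → H2} {f : H2} (h : HasSum u f) (z : Bidisk) :
    HasSum (fun i => (u i).ev z) (f.ev z) := by
  simp only [H2.ev_eq_inner]
  exact h.mapL (innerSL ℂ (szego z))

/-- Multiplication by `φ` is an isometry of `H²(𝔻²)` if it maps the monomials to an orthonormal
family. -/
lemma exists_mul_isometry {φ : ℂ × ℂ → ℂ} {v : ℕ × ℕ → H2} (hv : Orthonormal ℂ v)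
    (hev : ∀ n (z : Bidisk), (v n).ev z = φ z * (z.1.1 ^ n.1 * z.1.2 ^ n.2)) :
    ∃ M : H2 →ₗᵢ[ℂ] H2, ∀ h (z : Bidisk), (M h).ev z = φ z * h.ev z := by
  refine ⟨hv.orthogonalFamily.linearIsometry, fun h z => ?_⟩
  refine (hasSum_ev (hv.orthogonalFamily.hasSum_linearIsometry h) z).unique ?_
  have h1 := (hasSum_inner_szego h z).mul_left (φ z)
  rw [← H2.ev_eq_inner] at h1
  refine h1.congr_fun fun n => ?_
  have : (LinearIsometry.toSpanSingleton ℂ H2 (hv.1 n)) (h n) = h n • v n := rfl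
  rw [this, H2.ev_smul, hev]
  ring

lemma exists_shift₁ :
    ∃ M : H2 →ₗᵢ[ℂ] H2, ∀ h (z : Bidisk), (M h).ev z = Prod.fst z.1 * h.ev z :=
  exists_mul_isometry (v := fun n => monomial (n.1 + 1, n.2))
    (orthonormal_monomial.comp _ fun m n h => by
      simp only [Prod.mk.injEq, add_left_inj] at h
      exact Prod.ext h.1 h.2)
    fun n z => by rw [ev_monomial]; ring

lemma exists_shift₂ :
    ∃ M : H2 →ₗᵢ[ℂ] H2, ∀ h (z : Bidisk), (M h).ev z = Prod.snd z.1 * h.ev z :=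
  exists_mul_isometry (v := fun n => monomial (n.1, n.2 + 1))
    (orthonormal_monomial.comp _ fun m n h => by
      simp only [Prod.mk.injEq, add_left_inj] at h
      exact Prod.ext h.1 h.2)
    fun n z => by rw [ev_monomial]; ring

/-- Multiplication by `z₁`. -/
def shift₁ : H2 →ₗᵢ[ℂ] H2 := exists_shift₁.choose

/-- Multiplication by `z₂`. -/
def shift₂ : H2 →ₗᵢ[ℂ] H2 := exists_shift₂.choose

lemma ev_shift₁ (h : H2) (z : Bidisk) : (shift₁ h).ev z = z.1.1 * h.ev z :=
  exists_shift₁.choose_spec h z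

lemma ev_shift₂ (h : H2) (z : Bidisk) : (shift₂ h).ev z = z.1.2 * h.ev z :=
  exists_shift₂.choose_spec h z

lemma ev_shift₁_pow (k : ℕ) (h : H2) (z : Bidisk) :
    ((shift₁ ^ k) h).ev z = z.1.1 ^ k * h.ev z := by
  induction k with
  | zero => simp
  | succ k ih =>
    rw [pow_succ' shift₁, LinearIsometry.coe_mul, Function.comp_apply, ev_shift₁, ih]; ring

lemma ev_shift₂_pow (k : ℕ) (h : H2) (z : Bidisk) :
    ((shift₂ ^ k) h).ev z = z.1.2 ^ k * h.ev z := by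
  induction k with
  | zero => simp
  | succ k ih =>
    rw [pow_succ' shift₂, LinearIsometry.coe_mul, Function.comp_apply, ev_shift₂, ih]; ring

lemma shift₁_monomial (n : ℕ × ℕ) : shift₁ (monomial n) = monomial (n.1 + 1, n.2) :=
  H2.ev_injective <| funext fun z => by rw [ev_shift₁, ev_monomial, ev_monomial]; ring

lemma shift₂_monomial (n : ℕ × ℕ) : shift₂ (monomial n) = monomial (n.1, n.2 + 1) :=
  H2.ev_injective <| funext fun z => by rw [ev_shift₂, ev_monomial, ev_monomial]; ring

lemma adjoint_shift₁_apply (f : H2) (n : ℕ × ℕ) :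
    ContinuousLinearMap.adjoint shift₁.toContinuousLinearMap f n = f (n.1 + 1, n.2) := by
  rw [← inner_monomial, ContinuousLinearMap.adjoint_inner_right]
  change inner ℂ (shift₁ (monomial n)) f = _
  rw [shift₁_monomial, inner_monomial]

lemma adjoint_shift₂_apply (f : H2) (n : ℕ × ℕ) :
    ContinuousLinearMap.adjoint shift₂.toContinuousLinearMap f n = f (n.1, n.2 + 1) := by
  rw [← inner_monomial, ContinuousLinearMap.adjoint_inner_right]
  change inner ℂ (shift₂ (monomial n)) f = _
  rw [shift₂_monomial, inner_monomial]

lemma shift₂_apply_succ (f : H2) (j k : ℕ) : shift₂ f (j, k + 1) = f (j, k) := by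
  rw [← inner_monomial (j, k + 1), ← shift₂_monomial (j, k), shift₂.inner_map_map, inner_monomial]

lemma shift₂_apply_zero (f : H2) (j : ℕ) : shift₂ f (j, 0) = 0 := by
  have h := ((hasSum_monomial f).mapL shift₂.toContinuousLinearMap).mapL
    (innerSL ℂ (monomial (j, 0)))
  rw [← inner_monomial]
  refine h.unique ?_
  refine hasSum_zero.congr_fun fun n => ?_
  simp [shift₂_monomial, inner_monomial, monomial_apply]

lemma commute_shift : Commute shift₁.toContinuousLinearMap shift₂.toContinuousLinearMap := by
  ext1 f
  refine H2.ev_injective (funext fun z => ?_)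
  change (shift₁ (shift₂ f)).ev z = (shift₂ (shift₁ f)).ev z
  simp only [ev_shift₁, ev_shift₂]
  ring

/-- On coefficients the two operators shift different indices; the boundary case is `k = 0`, where
both sides vanish. -/
lemma commute_adjoint_shift :
    Commute (ContinuousLinearMap.adjoint shift₁.toContinuousLinearMap)
      shift₂.toContinuousLinearMap := by
  ext1 f
  refine lp.ext (funext fun ⟨j, k⟩ => ?_)
  change ContinuousLinearMap.adjoint shift₁.toContinuousLinearMap (shift₂ f) (j, k) =
    shift₂ (ContinuousLinearMap.adjoint shift₁.toContinuousLinearMap f) (j, k)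
  rw [adjoint_shift₁_apply]
  cases k with
  | zero => rw [shift₂_apply_zero, shift₂_apply_zero]
  | succ k => rw [shift₂_apply_succ, shift₂_apply_succ, adjoint_shift₁_apply]

lemma isShiftPair : IsShiftPair shift₁.toContinuousLinearMap shift₂.toContinuousLinearMap
    (monomial 0) where
  norm_fst := shift₁.norm_map
  norm_snd := shift₂.norm_map
  comm := commute_shift
  adjoint_comm := commute_adjoint_shift
  adjoint_apply := lp.ext (funext fun n => by
    rw [adjoint_shift₁_apply, monomial_apply, if_neg (by simp [Prod.ext_iff])]; rfl)
  orthonormal := by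
    have h : ∀ k : ℕ, (shift₂.toContinuousLinearMap ^ k) (monomial 0) = monomial (0, k) := by
      intro k
      induction k with
      | zero => rfl
      | succ k ih =>
        rw [pow_succ', mul_apply_eq_comp, ih]
        exact shift₂_monomial _
    simp only [h]
    exact orthonormal_monomial.comp _ fun i j hij => (Prod.mk.inj hij).2

lemma isShiftPair_swap : IsShiftPair shift₂.toContinuousLinearMap shift₁.toContinuousLinearMap
    (monomial 0) where
  norm_fst := shift₂.norm_map
  norm_snd := shift₁.norm_map
  comm := commute_shift.symm
  adjoint_comm := by
    have := congrArg star commute_adjoint_shift.eq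
    simp only [star_mul, ← ContinuousLinearMap.star_eq_adjoint, star_star] at this
    exact this
  adjoint_apply := lp.ext (funext fun n => by
    rw [adjoint_shift₂_apply, monomial_apply, if_neg (by simp [Prod.ext_iff])]; rfl)
  orthonormal := by
    have h : ∀ k : ℕ, (shift₁.toContinuousLinearMap ^ k) (monomial 0) = monomial (k, 0) := by
      intro k
      induction k with
      | zero => rfl
      | succ k ih =>
        rw [pow_succ', mul_apply_eq_comp, ih]
        exact shift₁_monomial _
    simp only [h]
    exact orthonormal_monomial.comp _ fun i j hij => (Prod.mk.inj hij).1

lemma ev_sub (f g : H2) (z : Bidisk) : (f - g).ev z = f.ev z - g.ev z := by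
  simp [H2.ev_eq_inner]

namespace BiPoly

variable {p : BiPoly} {τ₁ τ₂ l γ : ℂ}

lemma Relations.exists_f_theta (h : p.Relations τ₁ τ₂ l γ) (hp : ∀ z ∈ bidisk, p.val z ≠ 0) :
    (∃ f : H2, ‖f‖ = 1 ∧ ∀ z : Bidisk, f.ev z = p.fFun l τ₂ z) ∧
    ∃ t : H2, ‖t‖ = 1 ∧ ∀ z : Bidisk, t.ev z = p.theta z := by
  obtain ⟨⟨f, hf1, hf⟩, t, ht1, ht⟩ := exists_unit_solutions isShiftPair (b := p.b) (d := p.d)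
    h.c_lt h.l_ne_zero h.norm_snd h.coeff_snd (by linarith [h.coeff_add, h.coeff_sub])
  refine ⟨⟨f, hf1, fun z => ?_⟩, t, ht1, fun z => ?_⟩
  · have h1 := congrArg (fun x : H2 => x.ev z) hf
    simp only [LinearIsometry.coe_toContinuousLinearMap, H2.ev_add, H2.ev_smul, ev_sub, ev_shift₁,
      ev_shift₂, ev_monomial] at h1
    rw [fFun, eq_div_iff (hp z z.2), val]
    simp at h1
    linear_combination h1
  · have h1 := congrArg (fun x : H2 => x.ev z) ht
    simp only [LinearIsometry.coe_toContinuousLinearMap, H2.ev_add, H2.ev_smul, ev_shift₁,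
      ev_shift₂, ev_monomial] at h1
    rw [theta, eq_div_iff (hp z z.2), val, val, refl]
    simp at h1
    linear_combination h1

/-- The shifts trade roles here, so the coefficients `b` and `c` do too. -/
lemma Relations.exists_g (h : p.Relations τ₁ τ₂ l γ) (hp : ∀ z ∈ bidisk, p.val z ≠ 0) :
    ∃ g : H2, ‖g‖ = 1 ∧ ∀ z : Bidisk, g.ev z = p.gFun γ τ₁ z := by
  obtain ⟨⟨g, hg1, hg⟩, -⟩ := exists_unit_solutions isShiftPair_swap (b := p.c) (d := p.d)
    h.b_lt h.γ_ne_zero h.norm_fst h.coeff_fst (by linarith [h.coeff_add, h.coeff_sub])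
  refine ⟨g, hg1, fun z => ?_⟩
  have h1 := congrArg (fun x : H2 => x.ev z) hg
  simp only [LinearIsometry.coe_toContinuousLinearMap, H2.ev_add, H2.ev_smul, ev_sub, ev_shift₁,
    ev_shift₂, ev_monomial] at h1
  rw [gFun, eq_div_iff (hp z z.2), val]
  simp at h1
  linear_combination h1

end BiPoly

/-! ### Resolving the Szegő kernel by the family attached to `Θ`. -/

lemma hasSum_prod_of_finite {κ : Type*} [Fintype κ] {f : κ × ℕ → ℂ} {a : κ → ℂ}
    (hs : ∀ i, Summable fun k => ‖f (i, k)‖) (h : ∀ i, HasSum (fun k => f (i, k)) (a i)) :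
    HasSum f (∑ i, a i) := by
  have h1 : Summable f := by
    refine Summable.of_norm ((summable_prod_of_nonneg fun _ => norm_nonneg _).mpr ⟨hs, ?_⟩)
    exact (hasSum_fintype _).summable
  have h2 := h1.hasSum.prod_fiberwise h
  rw [← h2.unique (hasSum_fintype _)]
  exact h1.hasSum

lemma hasSum_finite_mul_geometric {κ : Type*} [Fintype κ] (c : κ → ℂ) {s : ℂ} (hs : ‖s‖ < 1) :
    HasSum (fun x : κ × ℕ => c x.1 * s ^ x.2) (∑ i, c i / (1 - s)) := by
  refine hasSum_prod_of_finite (fun i => ?_) fun i => ?_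
  · simpa only [norm_mul] using (summable_norm_geometric_of_norm_lt_one hs).mul_left ‖c i‖
  · rw [div_eq_mul_inv]
    exact (hasSum_geometric_of_norm_lt_one hs).mul_left (c i)

lemma norm_mul_conj_lt_one {x y : ℂ} (hx : ‖x‖ < 1) (hy : ‖y‖ < 1) : ‖x * conj y‖ < 1 := by
  rw [norm_mul, RCLike.norm_conj]
  exact mul_lt_one_of_nonneg_of_lt_one_left (norm_nonneg _) hx hy.le

lemma hasSum_geometric_prod {q r : ℂ} (hq : ‖q‖ < 1) (hr : ‖r‖ < 1) :
    HasSum (fun n : ℕ × ℕ => q ^ n.1 * r ^ n.2) (1 / ((1 - q) * (1 - r))) := by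
  rw [one_div, mul_inv]
  exact (hasSum_geometric_of_norm_lt_one hq).mul (hasSum_geometric_of_norm_lt_one hr)
    (summable_mul_of_summable_norm (summable_norm_geometric_of_norm_lt_one hq)
      (summable_norm_geometric_of_norm_lt_one hr))

lemma inner_szego_szego (z w : Bidisk) :
    inner ℂ (szego z) (szego w) =
      1 / ((1 - z.1.1 * conj w.1.1) * (1 - z.1.2 * conj w.1.2)) := by
  refine (hasSum_inner_szego (szego w) z).unique ((hasSum_geometric_prod
    (norm_mul_conj_lt_one z.2.1 w.2.1) (norm_mul_conj_lt_one z.2.2 w.2.2)).congr_fun fun n => ?_)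
  simp only [szego, map_mul, map_pow]
  ring

/-- The index set of the bases of `H²(𝔻²)` below. -/
abbrev Index (m : ℕ) : Type := (Fin m × ℕ) ⊕ (Fin m × ℕ) ⊕ (ℕ × ℕ)

/-- The family consisting of the `z₂ ^ k * u i`, the `z₁ ^ k * v i` and the `z₁ ^ j * z₂ ^ k * t`. -/
def family {m : ℕ} (u v : Fin m → H2) (t : H2) : Index m → H2 :=
  Sum.elim (fun x => (shift₂ ^ x.2) (u x.1))
    (Sum.elim (fun x => (shift₁ ^ x.2) (v x.1)) fun n => (shift₁ ^ n.1) ((shift₂ ^ n.2) t))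

lemma sum_partialProd_mul {m : ℕ} (x : Fin m → ℂ) :
    ∑ i, (∏ k ∈ Finset.Iio i, x k) * (1 - x i) = 1 - ∏ i, x i := by
  -- The ordered expansion of `∏ (1 - yᵢ)`, taken at `yᵢ = 1 - xᵢ`.
  have h := Finset.prod_one_sub_ordered Finset.univ fun i => 1 - x i
  simp only [sub_sub_cancel] at h
  rw [h, sub_sub_cancel]
  refine Finset.sum_congr rfl fun i _ => ?_
  rw [mul_comm]
  congr 2
  ext k; simp

section Family

variable {m : ℕ} {p : Fin m → BiPoly} {τ₁ τ₂ l γ : Fin m → ℂ} {u v : Fin m → H2} {t : H2}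

lemma hasSum_family_kernel
    (h : ∀ i, (p i).Relations (τ₁ i) (τ₂ i) (l i) (γ i))
    (hp : ∀ i, ∀ z ∈ bidisk, (p i).val z ≠ 0)
    (hu : ∀ i (z : Bidisk), (u i).ev z = partialProd p i z * (p i).fFun (l i) (τ₂ i) z)
    (hv : ∀ i (z : Bidisk), (v i).ev z = partialProd p i z * (p i).gFun (γ i) (τ₁ i) z)
    (ht : ∀ z : Bidisk, t.ev z = bigTheta p z) (z w : Bidisk) :
    HasSum (fun n => inner ℂ (szego z) (family u v t n) * inner ℂ (family u v t n) (szego w))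
      (inner ℂ (szego z) (szego w)) := by
  set q := z.1.1 * conj w.1.1 with hq
  set r := z.1.2 * conj w.1.2 with hr
  have hq1 : ‖q‖ < 1 := norm_mul_conj_lt_one z.2.1 w.2.1
  have hr1 : ‖r‖ < 1 := norm_mul_conj_lt_one z.2.2 w.2.2
  have hq0 : 1 - q ≠ 0 := sub_ne_zero.mpr fun h => by rw [← h] at hq1; simp at hq1
  have hr0 : 1 - r ≠ 0 := sub_ne_zero.mpr fun h => by rw [← h] at hr1; simp at hr1
  have hin : ∀ x : H2, inner ℂ (szego z) x * inner ℂ x (szego w) = x.ev z * conj (x.ev w) :=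
    fun x => by rw [H2.ev_eq_inner, H2.ev_eq_inner, inner_conj_symm]
  simp only [hin]
  have e2 : ∀ i (k : ℕ), ((shift₂ ^ k) (u i)).ev z * conj (((shift₂ ^ k) (u i)).ev w) =
      ((u i).ev z * conj ((u i).ev w)) * r ^ k := fun i k => by
    rw [ev_shift₂_pow, ev_shift₂_pow, hr, map_mul, map_pow]; ring
  have e1 : ∀ i (k : ℕ), ((shift₁ ^ k) (v i)).ev z * conj (((shift₁ ^ k) (v i)).ev w) =
      ((v i).ev z * conj ((v i).ev w)) * q ^ k := fun i k => by
    rw [ev_shift₁_pow, ev_shift₁_pow, hq, map_mul, map_pow]; ring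
  have h2 : HasSum (fun x : Fin m × ℕ => ((shift₂ ^ x.2) (u x.1)).ev z *
      conj (((shift₂ ^ x.2) (u x.1)).ev w)) (∑ i, (u i).ev z * conj ((u i).ev w) / (1 - r)) := by
    refine (hasSum_finite_mul_geometric (fun i => (u i).ev z * conj ((u i).ev w)) hr1).congr_fun ?_
    exact fun x => e2 x.1 x.2
  have h1 : HasSum (fun x : Fin m × ℕ => ((shift₁ ^ x.2) (v x.1)).ev z *
      conj (((shift₁ ^ x.2) (v x.1)).ev w)) (∑ i, (v i).ev z * conj ((v i).ev w) / (1 - q)) := by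
    refine (hasSum_finite_mul_geometric (fun i => (v i).ev z * conj ((v i).ev w)) hq1).congr_fun ?_
    exact fun x => e1 x.1 x.2
  have h3 : HasSum (fun n : ℕ × ℕ => ((shift₁ ^ n.1) ((shift₂ ^ n.2) t)).ev z *
      conj (((shift₁ ^ n.1) ((shift₂ ^ n.2) t)).ev w))
      (t.ev z * conj (t.ev w) * (1 / ((1 - q) * (1 - r)))) := by
    refine ((hasSum_geometric_prod hq1 hr1).mul_left _).congr_fun fun n => ?_
    rw [ev_shift₁_pow, ev_shift₁_pow, ev_shift₂_pow, ev_shift₂_pow, hq, hr]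
    simp only [map_mul, map_pow]
    ring
  have hsum := HasSum.sum (f := fun n : Index m => (family u v t n).ev z *
    conj ((family u v t n).ev w)) h2 (HasSum.sum h1 h3)
  convert hsum using 1
  rw [inner_szego_szego, ← hq, ← hr]
  -- The Agler decomposition of `θᵢ`, divided by `(1 - q)(1 - r)` and multiplied by the preceding
  -- factors.
  have hX : ∀ i, (u i).ev z * conj ((u i).ev w) / (1 - r) +
      (v i).ev z * conj ((v i).ev w) / (1 - q) =
      (∏ k ∈ Finset.Iio i, (p k).theta z * conj ((p k).theta w)) *
        (1 - (p i).theta z * conj ((p i).theta w)) * (1 / ((1 - q) * (1 - r))) := fun i => by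
    rw [(h i).agler (hp i z z.2) (hp i w w.2), ← hq, ← hr, hu, hu, hv, hv, Finset.prod_mul_distrib,
      ← map_prod, map_mul, map_mul]
    simp only [partialProd]
    field_simp
  have hΘ : t.ev z * conj (t.ev w) = ∏ i, (p i).theta z * conj ((p i).theta w) := by
    rw [ht, ht, bigTheta, bigTheta, map_prod, Finset.prod_mul_distrib]
  rw [← add_assoc, ← Finset.sum_add_distrib, Finset.sum_congr rfl fun i _ => hX i,
    ← Finset.sum_mul, sum_partialProd_mul, hΘ]
  ring

lemma family_isBasis
    (h : ∀ i, (p i).Relations (τ₁ i) (τ₂ i) (l i) (γ i))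
    (hp : ∀ i, ∀ z ∈ bidisk, (p i).val z ≠ 0)
    (hu : ∀ i (z : Bidisk), (u i).ev z = partialProd p i z * (p i).fFun (l i) (τ₂ i) z)
    (hv : ∀ i (z : Bidisk), (v i).ev z = partialProd p i z * (p i).gFun (γ i) (τ₁ i) z)
    (ht : ∀ z : Bidisk, t.ev z = bigTheta p z)
    (hu1 : ∀ i, ‖u i‖ = 1) (hv1 : ∀ i, ‖v i‖ = 1) (ht1 : ‖t‖ = 1) :
    Orthonormal ℂ (family u v t) ∧ (Submodule.span ℂ (Set.range (family u v t)))ᗮ = ⊥ := by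
  refine orthonormal_of_hasSum_kernel (k := szego) (fun x hx => inner_szego_injective x hx) ?_
    (hasSum_family_kernel h hp hu hv ht)
  rintro (⟨i, k⟩ | ⟨i, k⟩ | ⟨j, k⟩) <;>
    simp only [family, Sum.elim_inl, Sum.elim_inr, LinearIsometry.norm_map, hu1, hv1, ht1]

end Family

/-- For a single factor the partial product is empty, so the unit norms of `f`, `g` and `θ` suffice
for the basis. Its third block consists of the monomials times `θ`, and their orthonormality is the
isometry. -/
lemma BiPoly.Relations.exists_mul_theta {p : BiPoly} {τ₁ τ₂ l γ : ℂ}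
    (h : p.Relations τ₁ τ₂ l γ) (hp : ∀ z ∈ bidisk, p.val z ≠ 0) :
    ∃ M : H2 →ₗᵢ[ℂ] H2, ∀ x (z : Bidisk), (M x).ev z = p.theta z * x.ev z := by
  obtain ⟨⟨f, hf1, hf⟩, t, ht1, ht⟩ := h.exists_f_theta hp
  obtain ⟨g, hg1, hg⟩ := h.exists_g hp
  have hb := family_isBasis (m := 1) (p := fun _ => p) (τ₁ := fun _ => τ₁) (τ₂ := fun _ => τ₂)
    (l := fun _ => l) (γ := fun _ => γ) (u := fun _ => f) (v := fun _ => g) (t := t)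
    (fun _ => h) (fun _ => hp) (fun i z => by
      have : Finset.Iio i = ∅ := by ext k; simp
      simp [partialProd, hf, this]) (fun i z => by
      have : Finset.Iio i = ∅ := by ext k; simp
      simp [partialProd, hg, this])
    (fun z => by simp [bigTheta, ht]) (fun _ => hf1) (fun _ => hg1) ht1
  refine exists_mul_isometry (v := fun n => (shift₁ ^ n.1) ((shift₂ ^ n.2) t))
    (hb.1.comp (fun n => Sum.inr (Sum.inr n)) fun m n hmn => by simpa using hmn) fun n z => ?_
  rw [ev_shift₁_pow, ev_shift₂_pow, ht]
  ring

lemma exists_mul_prod {ι : Type*} {φ : ι → ℂ × ℂ → ℂ}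
    (h : ∀ i, ∃ M : H2 →ₗᵢ[ℂ] H2, ∀ x (z : Bidisk), (M x).ev z = φ i z * x.ev z) (s : Finset ι) :
    ∃ M : H2 →ₗᵢ[ℂ] H2, ∀ x (z : Bidisk), (M x).ev z = (∏ i ∈ s, φ i z) * x.ev z := by
  classical
  induction s using Finset.induction_on with
  | empty => exact ⟨LinearIsometry.id, fun x z => by simp⟩
  | insert i s hi ih =>
    obtain ⟨M, hM⟩ := ih
    obtain ⟨N, hN⟩ := h i
    refine ⟨N.comp M, fun x z => ?_⟩
    change (N (M x)).ev z = _
    rw [hN, hM, Finset.prod_insert hi, mul_assoc]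

lemma IsReproducingKernel.kernelSpace {S : Submodule ℂ H2} [CompleteSpace S]
    {k : Bidisk → Bidisk → ℂ} (h : IsReproducingKernel S k) :
    IsReproducingKernel (BidiskModel.kernelSpace k) k := by
  have hS := eq_kernelSpace S k h
  subst hS
  exact h

/-- The closed span of an orthonormal family has the reproducing kernel
`∑ v n (z) conj (v n (w))`. -/
lemma isReproducingKernel_of_hasSum {ι : Type*} {v : ι → H2} (hv : Orthonormal ℂ v)
    {k : Bidisk → Bidisk → ℂ}
    (hk : ∀ z w, HasSum (fun n => (v n).ev z * conj ((v n).ev w)) (k z w)) :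
    IsReproducingKernel (Submodule.span ℂ (Set.range v)).topologicalClosure k := by
  intro z w
  set W := (Submodule.span ℂ (Set.range v)).topologicalClosure with hW
  have hvW : ∀ n, v n ∈ W := fun n =>
    Submodule.le_topologicalClosure _ (Submodule.subset_span ⟨n, rfl⟩)
  set h : W := RKHS.kerFun W w 1 with hh
  have hinner : ∀ n, inner ℂ (v n) (h : H2) = conj ((v n).ev w) := fun n => by
    have h1 := RKHS.inner_kerFun (H := W) w 1 ⟨v n, hvW n⟩
    have h2 : (⟨v n, hvW n⟩ : W) w = (v n).ev w := congrFun (H2.coeCLM_eq_ev (v n)) w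
    rw [h2] at h1
    have h3 : inner ℂ (v n) (h : H2) = inner ℂ ((v n).ev w) 1 := h1
    rw [h3]
    simp
  obtain ⟨x, hx⟩ : Summable fun n => inner ℂ (v n) (h : H2) • v n := by
    have := (hv.orthogonalFamily.summable_iff_norm_sq_summable
      (f := fun n => inner ℂ (v n) (h : H2))).mpr (hv.inner_products_summable (x := (h : H2)))
    simpa using this
  have hxW : x ∈ W := (Submodule.isClosed_topologicalClosure _).mem_of_tendsto hx
    (Filter.Eventually.of_forall fun s => W.sum_mem fun n _ => W.smul_mem _ (hvW n))
  have hxv : ∀ n, inner ℂ (v n) x = inner ℂ (v n) (h : H2) := fun n => by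
    classical
    refine (hx.mapL (innerSL ℂ (v n))).unique ((hasSum_ite_eq n _).congr_fun fun i => ?_)
    rw [map_smul, innerSL_apply_apply, orthonormal_iff_ite.mp hv, smul_eq_mul]
    by_cases hi : i = n
    · subst hi; simp
    · simp [hi, Ne.symm hi]
  -- The kernel function and the sum of its expansion both lie in `W`, and their difference is
  -- orthogonal to `W`.
  have hxh : (h : H2) = x := by
    have h1 : (h : H2) - x ∈ (Submodule.span ℂ (Set.range v))ᗮ := by
      rw [Submodule.mem_orthogonal]
      intro y hy
      induction hy using Submodule.span_induction with
      | mem y hy => obtain ⟨n, rfl⟩ := hy; rw [inner_sub_right, hxv, sub_self]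
      | zero => exact inner_zero_left _
      | add a b _ _ ha hb => rw [inner_add_left, ha, hb, add_zero]
      | smul c a _ ha => rw [inner_smul_left, ha, mul_zero]
    rw [← Submodule.orthogonal_closure] at h1
    have h2 := (Submodule.mem_orthogonal _ _).mp h1 _ (W.sub_mem h.2 hxW)
    exact sub_eq_zero.mp (inner_self_eq_zero.mp h2)
  have h3 := hasSum_ev hx z
  rw [← hxh] at h3
  have h4 : RKHS.kernel W z w 1 = (h : H2).ev z := by
    rw [← RKHS.kerFun_apply]
    exact congrFun (H2.coeCLM_eq_ev (h : H2)) z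
  rw [h4]
  refine h3.unique ((hk z w).congr_fun fun n => ?_)
  rw [H2.ev_smul, hinner, mul_comm]

lemma mulSpace_eq_map {φ : ℂ × ℂ → ℂ} {M : H2 →ₗᵢ[ℂ] H2}
    (hM : ∀ x (z : Bidisk), (M x).ev z = φ z * x.ev z) (S : Submodule ℂ H2) :
    mulSpace φ S = S.map M.toLinearMap := by
  ext h
  rw [Submodule.mem_map]
  constructor
  · rintro ⟨g, hg, hgh⟩
    exact ⟨g, hg, H2.ev_injective (funext fun z => (hM g z).trans (hgh z).symm)⟩
  · rintro ⟨g, hg, rfl⟩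
    exact ⟨g, hg, hM g⟩

lemma closure_span_monomial :
    (Submodule.span ℂ (Set.range monomial)).topologicalClosure = ⊤ := by
  refine (Submodule.eq_top_iff'.mpr fun f => ?_)
  exact (Submodule.isClosed_topologicalClosure _).mem_of_tendsto (hasSum_monomial f)
    (Filter.Eventually.of_forall fun s => Submodule.le_topologicalClosure _
      (Submodule.sum_mem _ fun n _ => Submodule.smul_mem _ _ (Submodule.subset_span ⟨n, rfl⟩)))

/-- As `κ` is finite, the span is closed, so a closed span is an algebraic one. -/
lemma exists_orthonormalBasis_of_eq_coordSubspace {E ι κ : Type*} [NormedAddCommGroup E]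
    [InnerProductSpace ℂ E] [Fintype κ] (b : HilbertBasis ι ℂ E) {σ : κ → ι}
    (hσ : Function.Injective σ) {S : Submodule ℂ E} (hS : S = coordSubspace b (Set.range σ)) :
    ∃ e : OrthonormalBasis κ ℂ S, ∀ i, (e i : E) = b (σ i) := by
  have hmem : ∀ i, b (σ i) ∈ S := fun i => hS ▸ basis_mem_coordSubspace b ⟨i, rfl⟩
  let v : κ → S := fun i => ⟨b (σ i), hmem i⟩
  have hv : Orthonormal ℂ v :=
    (S.subtypeₗᵢ.orthonormal_comp_iff).mp (b.orthonormal.comp σ hσ)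
  have hspan : ⊤ ≤ Submodule.span ℂ (Set.range v) := fun x _ => by
    have h1 : (x : E) ∈ (Submodule.span ℂ (Set.range fun i => b (σ i))).topologicalClosure := by
      rw [coordSubspace_eq_closure b σ fun _ => rfl, ← hS]; exact x.2
    have : FiniteDimensional ℂ (Submodule.span ℂ (Set.range fun i => b (σ i))) :=
      FiniteDimensional.span_of_finite ℂ (Set.finite_range _)
    rw [(Submodule.closed_of_finiteDimensional _).submodule_topologicalClosure_eq] at h1
    have h2 : (Set.range fun i => b (σ i)) = S.subtype '' Set.range v := by
      rw [← Set.range_comp]; rfl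
    rw [h2, ← Submodule.map_span] at h1
    obtain ⟨y, hy, hyx⟩ := h1
    rwa [← Subtype.ext hyx]
  exact ⟨OrthonormalBasis.mk hv hspan, fun i => by rw [OrthonormalBasis.coe_mk]⟩

lemma isReproducingKernel_shift₂ {p : BiPoly} {l τ₂ : ℂ} {f : H2}
    (hf : ∀ z : Bidisk, f.ev z = p.fFun l τ₂ z) (ho : Orthonormal ℂ fun k : ℕ => (shift₂ ^ k) f) :
    IsReproducingKernel
      (Submodule.span ℂ (Set.range fun k : ℕ => (shift₂ ^ k) f)).topologicalClosure
      (p.kernel₂ l τ₂) :=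
  isReproducingKernel_of_hasSum ho fun z w => by
    rw [BiPoly.kernel₂, div_eq_mul_inv]
    refine ((hasSum_geometric_of_norm_lt_one (norm_mul_conj_lt_one z.2.2 w.2.2)).mul_left
      _).congr_fun fun k => ?_
    rw [ev_shift₂_pow, ev_shift₂_pow, hf, hf]
    simp only [map_mul, map_pow]
    ring

lemma isReproducingKernel_shift₁ {p : BiPoly} {γ τ₁ : ℂ} {g : H2}
    (hg : ∀ z : Bidisk, g.ev z = p.gFun γ τ₁ z) (ho : Orthonormal ℂ fun k : ℕ => (shift₁ ^ k) g) :
    IsReproducingKernel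
      (Submodule.span ℂ (Set.range fun k : ℕ => (shift₁ ^ k) g)).topologicalClosure
      (p.kernel₁ γ τ₁) :=
  isReproducingKernel_of_hasSum ho fun z w => by
    rw [BiPoly.kernel₁, div_eq_mul_inv]
    refine ((hasSum_geometric_of_norm_lt_one (norm_mul_conj_lt_one z.2.1 w.2.1)).mul_left
      _).congr_fun fun k => ?_
    rw [ev_shift₁_pow, ev_shift₁_pow, hg, hg]
    simp only [map_mul, map_pow]
    ring

/-! ### The adapted basis and the subspaces of the theorem as coordinate subspaces. -/

/-- A Hilbert basis of `H²(𝔻²)` adapted to `Θ = ∏ θ_i`. -/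
structure IsAdapted {m : ℕ} (p : Fin m → BiPoly) (τ₁ τ₂ l γ : Fin m → ℂ)
    (b : HilbertBasis (Index m) ℂ H2) : Prop where
  ev_basis : ∀ i (z : Bidisk),
    (b (.inl (i, 0))).ev z = partialProd p i z * (p i).fFun (l i) (τ₂ i) z
  shift₁_basis : ∀ i k, shift₁ (b (.inr (.inl (i, k)))) = b (.inr (.inl (i, k + 1)))
  shift₂_basis : ∀ i k, shift₂ (b (.inl (i, k))) = b (.inl (i, k + 1))
  isReproducingKernel₁ : ∀ i, IsReproducingKernel
    (kernelSpace ((p i).kernel₁ (γ i) (τ₁ i))) ((p i).kernel₁ (γ i) (τ₁ i))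
  isReproducingKernel₂ : ∀ i, IsReproducingKernel
    (kernelSpace ((p i).kernel₂ (l i) (τ₂ i))) ((p i).kernel₂ (l i) (τ₂ i))
  piece₁_eq : ∀ i, piece₁ p γ τ₁ i =
    coordSubspace b (Set.range fun k : ℕ => Sum.inr (Sum.inl (i, k)))
  piece₂_eq : ∀ i, piece₂ p l τ₂ i = coordSubspace b (Set.range fun k : ℕ => Sum.inl (i, k))
  mulSpace_eq : mulSpace (bigTheta p) ⊤ =
    coordSubspace b (Set.range fun n : ℕ × ℕ => Sum.inr (Sum.inr n))

theorem exists_isAdapted {m : ℕ} {p : Fin m → BiPoly} {τ₁ τ₂ l γ : Fin m → ℂ}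
    (h : ∀ i, (p i).Relations (τ₁ i) (τ₂ i) (l i) (γ i))
    (hp : ∀ i, ∀ z ∈ bidisk, (p i).val z ≠ 0) :
    ∃ b : HilbertBasis (Index m) ℂ H2, IsAdapted p τ₁ τ₂ l γ b := by
  choose f hf1 hf using fun i => ((h i).exists_f_theta (hp i)).1
  choose g hg1 hg using fun i => (h i).exists_g (hp i)
  have hprod := exists_mul_prod fun i => (h i).exists_mul_theta (hp i)
  choose M hM using fun i => hprod (Finset.Iio i)
  obtain ⟨N, hN⟩ := hprod Finset.univ
  have hu : ∀ i (z : Bidisk), (M i (f i)).ev z =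
      partialProd p i z * (p i).fFun (l i) (τ₂ i) z := fun i z => by rw [hM, hf]; rfl
  have hv : ∀ i (z : Bidisk), (M i (g i)).ev z =
      partialProd p i z * (p i).gFun (γ i) (τ₁ i) z := fun i z => by rw [hM, hg]; rfl
  have ht : ∀ z : Bidisk, (N (monomial 0)).ev z = bigTheta p z := fun z => by
    rw [hN, ev_monomial]; simp [bigTheta]
  obtain ⟨ho, hbot⟩ := family_isBasis h hp hu hv ht
    (fun i => by rw [LinearIsometry.norm_map, hf1]) (fun i => by rw [LinearIsometry.norm_map, hg1])
    (by rw [LinearIsometry.norm_map, orthonormal_monomial.1])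
  let b := HilbertBasis.mkOfOrthogonalEqBot ho hbot
  have hb : ∀ n, b n = family (fun i => M i (f i)) (fun i => M i (g i)) (N (monomial 0)) n :=
    fun n => congrFun (HilbertBasis.coe_mkOfOrthogonalEqBot ho hbot) n
  have hb2 : ∀ i k, M i ((shift₂ ^ k) (f i)) = b (.inl (i, k)) := fun i k => by
    rw [hb]
    refine H2.ev_injective (funext fun z => ?_)
    simp only [family, Sum.elim_inl, hM, ev_shift₂_pow]
    ring
  have hb1 : ∀ i k, M i ((shift₁ ^ k) (g i)) = b (.inr (.inl (i, k))) := fun i k => by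
    rw [hb]
    refine H2.ev_injective (funext fun z => ?_)
    simp only [family, Sum.elim_inl, Sum.elim_inr, hM, ev_shift₁_pow]
    ring
  have hb3 : ∀ n, N (monomial n) = b (.inr (.inr n)) := fun n => by
    rw [hb]
    refine H2.ev_injective (funext fun z => ?_)
    simp only [family, Sum.elim_inr, hN, ev_shift₁_pow, ev_shift₂_pow, ev_monomial]
    simp
    ring
  -- Orthonormality of `z₂ᵏ fᵢ` is pulled back from the basis `b` along the isometry `M i`.
  have hk2 : ∀ i, IsReproducingKernel
      (Submodule.span ℂ (Set.range fun k : ℕ => (shift₂ ^ k) (f i))).topologicalClosure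
      ((p i).kernel₂ (l i) (τ₂ i)) := fun i =>
    isReproducingKernel_shift₂ (hf i) ((M i).orthonormal_comp_iff.mp (by
      have := b.orthonormal.comp (fun k : ℕ => Sum.inl (i, k)) fun j k hjk => by simpa using hjk
      convert this using 1
      exact funext fun k => hb2 i k))
  have hk1 : ∀ i, IsReproducingKernel
      (Submodule.span ℂ (Set.range fun k : ℕ => (shift₁ ^ k) (g i))).topologicalClosure
      ((p i).kernel₁ (γ i) (τ₁ i)) := fun i =>
    isReproducingKernel_shift₁ (hg i) ((M i).orthonormal_comp_iff.mp (by
      have := b.orthonormal.comp (fun k : ℕ => Sum.inr (Sum.inl (i, k)))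
        fun j k hjk => by simpa using hjk
      convert this using 1
      exact funext fun k => hb1 i k))
  refine ⟨b, fun i z => ?_, fun i k => ?_, fun i k => ?_, fun i => (hk1 i).kernelSpace,
    fun i => (hk2 i).kernelSpace, fun i => ?_, fun i => ?_, ?_⟩
  · rw [← hb2, hM, ev_shift₂_pow, hf]; simp [partialProd]
  · rw [← hb1, ← hb1]
    refine H2.ev_injective (funext fun z => ?_)
    simp only [hM, ev_shift₁, ev_shift₁_pow]
    ring
  · rw [← hb2, ← hb2]
    refine H2.ev_injective (funext fun z => ?_)
    simp only [hM, ev_shift₂, ev_shift₂_pow]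
    ring
  · rw [piece₁, ← eq_kernelSpace _ _ (hk1 i), mulSpace_eq_map (φ := partialProd p i) (hM i),
      map_closure_span_range]
    exact coordSubspace_eq_closure b _ (hb1 i)
  · rw [piece₂, ← eq_kernelSpace _ _ (hk2 i), mulSpace_eq_map (φ := partialProd p i) (hM i),
      map_closure_span_range]
    exact coordSubspace_eq_closure b _ (hb2 i)
  · rw [mulSpace_eq_map (φ := bigTheta p) hN, ← closure_span_monomial, map_closure_span_range]
    exact coordSubspace_eq_closure b _ hb3

namespace IsAdapted

variable {m : ℕ} {p : Fin m → BiPoly} {τ₁ τ₂ l γ : Fin m → ℂ} {b : HilbertBasis (Index m) ℂ H2}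

lemma S₁_eq (h : IsAdapted p τ₁ τ₂ l γ b) :
    S₁ p γ τ₁ = coordSubspace b (Set.range fun x : Fin m × ℕ => Sum.inr (Sum.inl x)) := by
  simp only [S₁, h.piece₁_eq, iSup_coordSubspace]
  congr 1
  ext n; simp

lemma S₂_eq (h : IsAdapted p τ₁ τ₂ l γ b) : S₂ p l τ₂ = coordSubspace b (Set.range Sum.inl) := by
  simp only [S₂, h.piece₂_eq, iSup_coordSubspace]
  congr 1
  ext n; simp

lemma modelSpace_eq (h : IsAdapted p τ₁ τ₂ l γ b) :
    modelSpace (bigTheta p) = S₁ p γ τ₁ ⊔ S₂ p l τ₂ := by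
  rw [modelSpace, h.mulSpace_eq, orthogonal_coordSubspace, h.S₁_eq, h.S₂_eq, coordSubspace_sup]
  congr 1
  ext (n | n | n) <;> simp

lemma map_shift₁_S₁ (h : IsAdapted p τ₁ τ₂ l γ b) :
    (S₁ p γ τ₁).map shift₁.toLinearMap =
    coordSubspace b (Set.range fun x : Fin m × ℕ => Sum.inr (Sum.inl (x.1, x.2 + 1))) := by
  rw [h.S₁_eq, ← coordSubspace_eq_closure b _ fun _ => rfl, map_closure_span_range]
  exact coordSubspace_eq_closure b _ fun x => h.shift₁_basis x.1 x.2

lemma map_shift₂_S₂ (h : IsAdapted p τ₁ τ₂ l γ b) :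
    (S₂ p l τ₂).map shift₂.toLinearMap =
    coordSubspace b (Set.range fun x : Fin m × ℕ => Sum.inl (x.1, x.2 + 1)) := by
  rw [h.S₂_eq, ← coordSubspace_eq_closure b _ fun _ => rfl, map_closure_span_range]
  exact coordSubspace_eq_closure b _ fun x => h.shift₂_basis x.1 x.2

lemma isMulInvariant_S₁ (h : IsAdapted p τ₁ τ₂ l γ b) :
    IsMulInvariant Prod.fst (S₁ p γ τ₁) := fun x hx => by
  refine ⟨shift₁ x, ?_, ev_shift₁ x⟩
  have h1 : shift₁ x ∈ (S₁ p γ τ₁).map shift₁.toLinearMap := ⟨x, hx, rfl⟩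
  rw [h.map_shift₁_S₁] at h1
  rw [h.S₁_eq]
  exact coordSubspace_mono b (by rintro _ ⟨y, rfl⟩; exact ⟨_, rfl⟩) h1

lemma isMulInvariant_S₂ (h : IsAdapted p τ₁ τ₂ l γ b) :
    IsMulInvariant Prod.snd (S₂ p l τ₂) := fun x hx => by
  refine ⟨shift₂ x, ?_, ev_shift₂ x⟩
  have h1 : shift₂ x ∈ (S₂ p l τ₂).map shift₂.toLinearMap := ⟨x, hx, rfl⟩
  rw [h.map_shift₂_S₂] at h1
  rw [h.S₂_eq]
  exact coordSubspace_mono b (by rintro _ ⟨y, rfl⟩; exact ⟨_, rfl⟩) h1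

/-- Multiplication by `z₂` raises `k` by one on the first block, so only the indices with `k = 0`
remain. -/
lemma HK₂_eq (h : IsAdapted p τ₁ τ₂ l γ b) :
    HK₂ p l τ₂ = coordSubspace b (Set.range fun i : Fin m => Sum.inl (i, 0)) := by
  rw [HK₂, mulSpace_eq_map ev_shift₂, h.map_shift₂_S₂, h.S₂_eq, orthogonal_coordSubspace,
    coordSubspace_inf]
  congr 1
  ext (⟨i, k⟩ | n)
  · cases k <;> simp
  · simp

end IsAdapted

end BidiskModel

end

theorem proposition4p3 (m : ℕ) (p : Fin m → BidiskModel.BiPoly) (τ₁ τ₂ l γ : Fin m → ℂ)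
    (hp : ∀ i, (p i).IsDegreeOneOneInner)
    (hτ₁ : ∀ i, ‖τ₁ i‖ = 1) (hτ₂ : ∀ i, ‖τ₂ i‖ = 1)
    (hsing : ∀ i, (p i).val (τ₁ i, τ₂ i) = 0)
    (hl : ∀ i, l i ^ 2 = conj (p i).a * (p i).c - (p i).d * conj (p i).b)
    (hγ : ∀ i, ‖γ i‖ ^ 2 = ‖conj (p i).a * (p i).b - (p i).d * conj (p i).c‖) :
    -- the spaces `𝒮_{j, θ_i}` are subspaces of `H²(𝔻²)` with the prescribed kernels
    (∀ i, BidiskModel.IsReproducingKernel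
        (BidiskModel.kernelSpace ((p i).kernel₁ (γ i) (τ₁ i))) ((p i).kernel₁ (γ i) (τ₁ i))) ∧
    (∀ i, BidiskModel.IsReproducingKernel
        (BidiskModel.kernelSpace ((p i).kernel₂ (l i) (τ₂ i))) ((p i).kernel₂ (l i) (τ₂ i))) ∧
    -- the sums that define `𝒮₁` and `𝒮₂` are orthogonal
    (∀ i j, i ≠ j → BidiskModel.piece₁ p γ τ₁ i ⟂ BidiskModel.piece₁ p γ τ₁ j) ∧
    (∀ i j, i ≠ j → BidiskModel.piece₂ p l τ₂ i ⟂ BidiskModel.piece₂ p l τ₂ j) ∧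
    -- `K_Θ = 𝒮₁ ⊕ 𝒮₂`
    BidiskModel.S₁ p γ τ₁ ⟂ BidiskModel.S₂ p l τ₂ ∧
    BidiskModel.S₁ p γ τ₁ ⊔ BidiskModel.S₂ p l τ₂ =
      BidiskModel.modelSpace (BidiskModel.bigTheta p) ∧
    -- the invariance of `𝒮₁` and `𝒮₂`
    BidiskModel.IsMulInvariant Prod.fst (BidiskModel.S₁ p γ τ₁) ∧
    BidiskModel.IsMulInvariant Prod.snd (BidiskModel.S₂ p l τ₂) ∧
    -- the orthonormal basis of `𝒮₂ ⊖ z₂ 𝒮₂`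
    ∃ e : OrthonormalBasis (Fin m) ℂ (BidiskModel.HK₂ p l τ₂),
      ∀ (i : Fin m) (z : BidiskModel.Bidisk),
        BidiskModel.H2.ev (e i) z = BidiskModel.partialProd p i z * (p i).fFun (l i) (τ₂ i) z := by
  obtain ⟨b, hb⟩ := BidiskModel.exists_isAdapted
    (fun i => (hp i).relations (hτ₁ i) (hτ₂ i) (hsing i) (hl i) (hγ i)) fun i => (hp i).ne_zero
  refine ⟨hb.isReproducingKernel₁, hb.isReproducingKernel₂, fun i j hij => ?_, fun i j hij => ?_,
    ?_, hb.modelSpace_eq.symm, hb.isMulInvariant_S₁, hb.isMulInvariant_S₂, ?_⟩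
  · rw [hb.piece₁_eq, hb.piece₁_eq]
    refine BidiskModel.isOrtho_coordSubspace b (Set.disjoint_left.mpr ?_)
    rintro _ ⟨k, rfl⟩ ⟨k', hk⟩
    simp at hk
    exact hij hk.1.symm
  · rw [hb.piece₂_eq, hb.piece₂_eq]
    refine BidiskModel.isOrtho_coordSubspace b (Set.disjoint_left.mpr ?_)
    rintro _ ⟨k, rfl⟩ ⟨k', hk⟩
    simp at hk
    exact hij hk.1.symm
  · rw [hb.S₁_eq, hb.S₂_eq]
    refine BidiskModel.isOrtho_coordSubspace b (Set.disjoint_left.mpr ?_)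
    rintro _ ⟨k, rfl⟩ ⟨k', hk⟩
    simp at hk
  · obtain ⟨e, he⟩ := BidiskModel.exists_orthonormalBasis_of_eq_coordSubspace b
      (fun i j hij => by simpa using hij) hb.HK₂_eq
    exact ⟨e, fun i z => by rw [he]; exact hb.ev_basis i z⟩
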